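/- Let $\mathbb R^{2,1}$ be $\mathbb R^3$ with $\langle x,y\rangle=x_1y_1+x_2y_2-x_3y_3$, and let $\mathbb H^2=\{x:\langle x,x\rangle=-1,\ x_3>0\}$. Let $\Gamma$ be a group of linear isometries of $\mathbb R^{2,1}$ preserving $\mathbb H^2$ and acting on it freely, properly discontinuously and cocompactly (so that $\mathbb H^2/\Gamma$ is a compact hyperbolic surface). For $u_1,\dots,u_m\in\mathbb H^2$ in pairwise distinct $\Gamma$-orbits and $r_1,\dots,r_m>0$, consider the convex $\Gamma$-polyhedron $$P=\{x:\ \langle x,\gamma u_i\rangle\le -r_i\ \text{ for all }\gamma\in\Gamma,\ 1\le i\le m\},$$ and assume that each of the planes $\{x:\langle x,\gamma u_i\rangle=-r_i\}$ meets $P$ in a two-dimensional face. The $r_i$ are the support numbers of $P$. Let $H^\Gamma(P)\subset\mathbb R^m$ be the set of support vectors $h$ of the convex $\Gamma$-polyhedra, in this same sense, with the same normals $u_i$ and with the same combinatorics as $P$ (corresponding families of faces have intersections of the same dimension). Label the faces $F_a$ of $P$ by $a=(\gamma,i)\in\Gamma\times\{1,\dots,m\}$, put $n_a=\gamma u_i$,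 and for $h\in\mathbb R^m$ put $h_a=h_i$. Write $F_i$ for the face with label $(1,i)$. If $F_a,F_b$ share an edge, let $\varphi_{ab}>0$ be given by $\cosh\varphi_{ab}=-\langle n_a,n_b\rangle$, and put $$h_{ab}=-\frac{h_b-h_a\cosh\varphi_{ab}}{\sinh\varphi_{ab}},\qquad v_{ab}=\frac{n_b-\cosh\varphi_{ab}\,n_a}{\sinh\varphi_{ab}},$$ the support number and the outward unit normal of that edge in the plane of $F_a$. The length of the edge is the linear function $$\ell_{ab}(h)=\sum_c\frac{h_{ac}-h_{ab}\cos\omega_{abc}}{\sin\omega_{abc}},\qquad \cos\omega_{abc}=\langle v_{ab},v_{ac}\rangle,\ \ \omega_{abc}\in(0,\pi),$$ where $c$ runs over the labels of the two edges $F_a\cap F_c$ of the polygon $F_a$ adjacent to the edge $F_a\cap F_b$. For $k,p,q\in\mathbb R^m$ define the mixed face areas and the mixed covolume by $$\mathfrak a_{F_a}(p_{a\bullet},q_{a\bullet})=\tfrac14\sum_b\bigl(p_{ab}\,\ell_{ab}(q)+q_{ab}\,\ell_{ab}(p)\bigr),\qquad \mathrm{covol}_P(k,p,q)=\tfrac13\sum_{i=1}^m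 k_i\,\mathfrak a_{F_i}(p_{i\bullet},q_{i\bullet}),$$ where $b$ runs over the labels of the faces sharing an edge with $F_a$. **Theorem.** For every $h\in H^\Gamma(P)$, the map $(k,p)\mapsto\mathrm{covol}_P(k,p,h)$ is a symmetric positive definite bilinear form on $\mathbb R^m$. -/

import Mathlib

noncomputable section

namespace Fuchsian

/-- The vector space underlying Minkowski space `ℝ^{2,1}`. -/
abbrev Mink : Type := Fin 3 → ℝ

/-- The Minkowski bilinear form `x₁y₁ + x₂y₂ - x₃y₃`. -/
def form (x y : Mink) : ℝ := x 0 * y 0 + x 1 * y 1 - x 2 * y 2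

/-- The hyperboloid model `ℍ²` of the hyperbolic plane. -/
def hyp : Set Mink := {x | form x x = -1 ∧ 0 < x 2}

/-- `Γ` is a group of linear isometries of `ℝ^{2,1}`, acting on `ℍ²`, such that `ℍ²/Γ` is a compact
hyperbolic surface: the action is free, properly discontinuous and cocompact. -/
structure IsFuchsianGroup (Γ : Subgroup (Mink ≃ₗ[ℝ] Mink)) : Prop where
  isometry : ∀ γ ∈ Γ, ∀ x y, form (γ x) (γ y) = form x y
  map_hyp : ∀ γ ∈ Γ, ∀ x ∈ hyp, γ x ∈ hyp
  free : ∀ γ ∈ Γ, ∀ x ∈ hyp, γ x = x → γ = 1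
  properlyDiscontinuous : ∀ K : Set Mink, K ⊆ hyp → IsCompact K →
    {γ : Mink ≃ₗ[ℝ] Mink | γ ∈ Γ ∧ (γ '' K ∩ K).Nonempty}.Finite
  cocompact : ∃ K : Set Mink, K ⊆ hyp ∧ IsCompact K ∧ ∀ x ∈ hyp, ∃ γ ∈ Γ, γ x ∈ K

variable {Γ : Subgroup (Mink ≃ₗ[ℝ] Mink)} {m : ℕ}

/-- The labels of the planes in the `Γ`-orbits of `m` planes: `(γ, i)` is the label of `γ Fᵢ`. -/
abbrev Label (Γ : Subgroup (Mink ≃ₗ[ℝ] Mink)) (m : ℕ) : Type := Γ × Fin m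

/-- The future unit normal of the plane labelled `a`, when `Fᵢ` has future unit normal `uᵢ`. -/
def normal (u : Fin m → Mink) (a : Label Γ m) : Mink := (a.1 : Mink ≃ₗ[ℝ] Mink) (u a.2)

/-- The intersection of the future sides `{x | ⟨x, γ uᵢ⟩ ≤ -hᵢ}` of the `Γ`-orbits of the planes
`{x | ⟨x, uᵢ⟩ = -hᵢ}`. For `uᵢ ∈ ℍ²` and `hᵢ > 0` the latter is the plane tangent to the
hyperboloid `ℍ²_r` of radius `r = hᵢ` at the point `hᵢ uᵢ`; every plane tangent to it
is of this form. -/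
def polyhedron (Γ : Subgroup (Mink ≃ₗ[ℝ] Mink)) (u : Fin m → Mink) (h : Fin m → ℝ) : Set Mink :=
  {x | ∀ a : Label Γ m, form x (normal u a) ≤ -h a.2}

/-- The intersection of the polyhedron with its bounding plane labelled `a`. -/
def face (u : Fin m → Mink) (h : Fin m → ℝ) (a : Label Γ m) : Set Mink :=
  {x | x ∈ polyhedron Γ u h ∧ form x (normal u a) = -h a.2}

/-- `u`, `h` are the unit normals and the support numbers of a convex `Γ`-polyhedron with exactly
`m` orbits of (two-dimensional) faces, numbered from `1` to `m`. -/
structure IsConvexPolyhedron (Γ : Subgroup (Mink ≃ₗ[ℝ] Mink)) (u : Fin m → Mink)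
    (h : Fin m → ℝ) : Prop where
  normal_mem : ∀ i, u i ∈ hyp
  support_pos : ∀ i, 0 < h i
  orbits_distinct : ∀ i j, ∀ γ ∈ Γ, γ (u i) = u j → i = j
  face_dim : ∀ a : Label Γ m, Module.finrank ℝ (vectorSpan ℝ (face u h a)) = 2

/-- Two polyhedra with the same face normals have the same combinatorics: any family of faces
of the first meets (meets in more than one point) if and only if the corresponding family of faces
of the second does. -/
def SameCombinatorics (Γ : Subgroup (Mink ≃ₗ[ℝ] Mink)) (u : Fin m → Mink)
    (h h' : Fin m → ℝ) : Prop :=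
  ∀ S : Set (Label Γ m),
    ((⋂ a ∈ S, face u h a).Nonempty ↔ (⋂ a ∈ S, face u h' a).Nonempty) ∧
    ((⋂ a ∈ S, face u h a).Nontrivial ↔ (⋂ a ∈ S, face u h' a).Nontrivial)

/-- `H^Γ(P)`, where `P` is the polyhedron with normals `u` and support numbers `r`: the convex
`Γ`-polyhedra with faces parallel to those of `P` and the same combinatorics as `P`, identified with
their vectors of support numbers. -/
def parallelClass (Γ : Subgroup (Mink ≃ₗ[ℝ] Mink)) (u : Fin m → Mink) (r : Fin m → ℝ) :
    Set (Fin m → ℝ) :=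
  {h | IsConvexPolyhedron Γ u h ∧ SameCombinatorics Γ u r h}

/-- The labels `b` such that the faces `a` and `b` of `P` have a common edge. They also label the
edges of the face `a`. -/
def neighbors (u : Fin m → Mink) (r : Fin m → ℝ) (a : Label Γ m) : Set (Label Γ m) :=
  {b | b ≠ a ∧ (face u r a ∩ face u r b).Nontrivial}

/-- The edges of the face `a` of `P` which are adjacent, in the polygon `a`, to its edge `b`. -/
def adjacentEdges (u : Fin m → Mink) (r : Fin m → ℝ) (a b : Label Γ m) : Set (Label Γ m) :=
  {c | c ∈ neighbors u r a ∧ c ≠ b ∧ (face u r a ∩ face u r b ∩ face u r c).Nonempty}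

/-- `φ_{ab}`: the hyperbolic distance between the unit normals of the planes `a` and `b`. -/
def phi (u : Fin m → Mink) (a b : Label Γ m) : ℝ :=
  Real.arcosh (-form (normal u a) (normal u b))

/-- The support number `h_{ab}` of the edge `b` of the face `a`, as a function of the support
numbers of the polyhedron. -/
def edgeSupport (u : Fin m → Mink) (h : Fin m → ℝ) (a b : Label Γ m) : ℝ :=
  -(h b.2 - h a.2 * Real.cosh (phi u a b)) / Real.sinh (phi u a b)

/-- The outward unit normal, in the plane `a`, of the edge `b` of the face `a`. -/
def edgeNormal (u : Fin m → Mink) (a b : Label Γ m) : Mink :=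
  (Real.sinh (phi u a b))⁻¹ • (normal u b - Real.cosh (phi u a b) • normal u a)

/-- `ω_{abc}`: the angle between the outward normals of the edges `b` and `c` of the face `a`. -/
def omega (u : Fin m → Mink) (a b c : Label Γ m) : ℝ :=
  Real.arccos (form (edgeNormal u a b) (edgeNormal u a c))

/-- The signed distance, on the line of the edge `b` of the face `a`, from the orthogonal projection
of the origin to the intersection with the line of the edge `c`. -/
def partialLength (u : Fin m → Mink) (h : Fin m → ℝ) (a b c : Label Γ m) : ℝ :=
  (edgeSupport u h a c - edgeSupport u h a b * Real.cos (omega u a b c)) /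
    Real.sin (omega u a b c)

/-- The length `ℓ_{ab}(h)` of the edge `b` of the face `a`, as a linear function of `h`. It is the
sum over the two edges adjacent to `b` in the face `a` of `P`. -/
def edgeLength (u : Fin m → Mink) (r h : Fin m → ℝ) (a b : Label Γ m) : ℝ :=
  ∑ᶠ c ∈ adjacentEdges u r a b, partialLength u h a b c

/-- The mixed area `𝔞_{F_a}(k_{a•}, p_{a•})` of the face `a` of `P`: the polarization of the area
`½ ∑_b h_{ab} ℓ_{ab}(h)`. The sum is over the (finitely many) edges of the face `a` of `P`. -/
def mixedArea (u : Fin m → Mink) (r k p : Fin m → ℝ) (a : Label Γ m) : ℝ :=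
  (1 / 4) * ∑ᶠ b ∈ neighbors u r a,
    (edgeSupport u k a b * edgeLength u r p a b + edgeSupport u p a b * edgeLength u r k a b)

/-- The mixed covolume `covol_P(k, p, q) = ⅓ ∑ᵢ kᵢ 𝔞_{Fᵢ}(p_{i•}, q_{i•})`, where `P` is the
polyhedron with normals `u` and support numbers `r`. -/
def mixedCovolume (Γ : Subgroup (Mink ≃ₗ[ℝ] Mink)) (u : Fin m → Mink) (r k p q : Fin m → ℝ) : ℝ :=
  (1 / 3) * ∑ i : Fin m, k i * mixedArea u r p q ((1, i) : Label Γ m)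

end Fuchsian

end

/-! The theorem is a diagonal dominance statement. Adjacency and angles in a face are symmetric in
its edges, so the two halves of the mixed area agree when one argument is `h`, and `𝔞_{F_a}(p, h) =
½ ∑_b p_{ab} ℓ_{ab}(h)`. Hence `covol_P(k, p, h) = (1/6) ∑ w_{ab} k_a (p_a cosh φ_{ab} - p_b)` over
the edges of the faces `Fᵢ`, with `w_{ab} = ℓ_{ab}(h) / sinh φ_{ab}`. The weight is `Γ`-invariant
and symmetric in `a`, `b`, and the sum counts each edge of the quotient from both sides. So the form
is symmetric, and its value at `(k, k)` is `(1/6) ∑ w_{ab} ((cosh φ_{ab} - 1) k_a² + ½ (k_a -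
k_b)²)`. This is positive for `k ≠ 0`, because `w > 0`, `cosh φ > 1` and every face has an edge.

The geometric work is to show that the algebraic expression `ℓ_{ab}(h)` is the true length of the
edge (`isGreatest_edgeLength`); positivity, symmetry and invariance all follow from this. It
requires exactly one adjacent edge at each endpoint (`exists_unique_adjacent_edge`, based on
`not_three_faces`). The finiteness behind it comes from cocompactness: the polyhedron lies in the
open future cone (`spaceNorm_lt_of_mem_polyhedron`), so its faces are compact and each meets only
finitely many others. -/

namespace Fuchsian

open Filter Topology

/-! ### Minkowski geometry of `ℝ^{2,1}` -/

section Form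

theorem form_comm (x y : Mink) : form x y = form y x := by simp only [form]; ring

theorem form_add_left (x y z : Mink) : form (x + y) z = form x z + form y z := by
  simp only [form, Pi.add_apply]; ring

theorem form_sub_left (x y z : Mink) : form (x - y) z = form x z - form y z := by
  simp only [form, Pi.sub_apply]; ring

theorem form_smul_left (t : ℝ) (x y : Mink) : form (t • x) y = t * form x y := by
  simp only [form, Pi.smul_apply, smul_eq_mul]; ring

theorem form_neg_left (x y : Mink) : form (-x) y = -form x y := by
  simp only [form, Pi.neg_apply]; ring

theorem form_add_right (x y z : Mink) : form x (y + z) = form x y + form x z := by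
  simp only [form, Pi.add_apply]; ring

theorem form_sub_right (x y z : Mink) : form x (y - z) = form x y - form x z := by
  simp only [form, Pi.sub_apply]; ring

theorem form_smul_right (t : ℝ) (x y : Mink) : form x (t • y) = t * form x y := by
  simp only [form, Pi.smul_apply, smul_eq_mul]; ring

theorem form_neg_right (x y : Mink) : form x (-y) = -form x y := by
  simp only [form, Pi.neg_apply]; ring

theorem continuous_form_left (y : Mink) : Continuous fun x => form x y := by
  unfold form; fun_prop

/-- A vector orthogonal to an orthonormal basis of Minkowski space vanishes. -/
theorem eq_zero_of_form_eq_zero {n v d y : Mink} (hn : form n n = -1) (hv : form v v = 1)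
    (hd : form d d = 1) (hnv : form n v = 0) (hnd : form n d = 0) (hvd : form v d = 0)
    (h₁ : form n y = 0) (h₂ : form v y = 0) (h₃ : form d y = 0) : y = 0 := by
  -- `D` is the determinant of `(n, v, d)`. Its square is minus the Gram determinant, and Cramer's
  -- rule gives `D * y i = 0`.
  set D := n 0 * (v 1 * d 2 - v 2 * d 1) - n 1 * (v 0 * d 2 - v 2 * d 0)
    + n 2 * (v 0 * d 1 - v 1 * d 0) with hD
  have hsq : D ^ 2 = 1 := by
    have : D ^ 2 = -(form n n * (form v v * form d d - form v d ^ 2)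
        - form n v * (form n v * form d d - form v d * form n d)
        + form n d * (form n v * form v d - form v v * form n d)) := by
      simp only [hD, form]; ring
    rw [this, hn, hv, hd, hnv, hnd, hvd]; norm_num
  have hD0 : D ≠ 0 := by
    intro h0
    rw [h0] at hsq
    norm_num at hsq
  unfold form at h₁ h₂ h₃
  have e0 : D * y 0 = 0 := by
    rw [hD]
    linear_combination (v 1 * d 2 - v 2 * d 1) * h₁ - (n 1 * d 2 - n 2 * d 1) * h₂
      + (n 1 * v 2 - n 2 * v 1) * h₃
  have e1 : D * y 1 = 0 := by
    rw [hD]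
    linear_combination -(v 0 * d 2 - v 2 * d 0) * h₁ + (n 0 * d 2 - n 2 * d 0) * h₂
      - (n 0 * v 2 - n 2 * v 0) * h₃
  have e2 : D * y 2 = 0 := by
    rw [hD]
    linear_combination -(v 0 * d 1 - v 1 * d 0) * h₁ + (n 0 * d 1 - n 1 * d 0) * h₂
      - (n 0 * v 1 - n 1 * v 0) * h₃
  ext i
  fin_cases i
  · exact (mul_eq_zero.1 e0).resolve_left hD0
  · exact (mul_eq_zero.1 e1).resolve_left hD0
  · exact (mul_eq_zero.1 e2).resolve_left hD0

/-- Expansion of a vector in an orthonormal basis of Minkowski space. -/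
theorem eq_orthonormal_expansion {n v d : Mink} (hn : form n n = -1) (hv : form v v = 1)
    (hd : form d d = 1) (hnv : form n v = 0) (hnd : form n d = 0) (hvd : form v d = 0)
    (x : Mink) : x = -form x n • n + form x v • v + form x d • d := by
  have hvn := form_comm v n ▸ hnv
  have hdn := form_comm d n ▸ hnd
  have hdv := form_comm d v ▸ hvd
  refine sub_eq_zero.1 (eq_zero_of_form_eq_zero hn hv hd hnv hnd hvd ?_ ?_ ?_) <;>
  simp only [form_sub_right, form_add_right, form_smul_right, hn, hv, hd, hnv, hnd, hvd, hvn, hdn,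
    hdv, form_comm x] <;> ring

/-- On the hyperboloid, `(x 2 * y 2) ^ 2 - (1 + x 0 * y 0 + x 1 * y 1) ^ 2` is a sum of squares that
vanishes only when the space components agree. -/
theorem one_lt_neg_form {x y : Mink} (hx : x ∈ hyp) (hy : y ∈ hyp) (hxy : x ≠ y) :
    1 < -form x y := by
  obtain ⟨hx, hx2⟩ := hx
  obtain ⟨hy, hy2⟩ := hy
  by_contra! hle
  refine hxy ?_
  unfold form at hx hy hle
  have hpos : 0 < x 2 * y 2 := mul_pos hx2 hy2
  have h1 : (x 2 * y 2) ^ 2 ≤ (1 + (x 0 * y 0 + x 1 * y 1)) ^ 2 := by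
    apply pow_le_pow_left₀ hpos.le; linarith
  have h2 : (x 2 * y 2) ^ 2 = (1 + (x 0 * y 0 + x 1 * y 1)) ^ 2
      + (x 0 - y 0) ^ 2 + (x 1 - y 1) ^ 2 + (x 0 * y 1 - x 1 * y 0) ^ 2 := by
    have ex : x 2 * x 2 = 1 + x 0 * x 0 + x 1 * x 1 := by linarith
    have ey : y 2 * y 2 = 1 + y 0 * y 0 + y 1 * y 1 := by linarith
    calc (x 2 * y 2) ^ 2 = (x 2 * x 2) * (y 2 * y 2) := by ring
      _ = _ := by rw [ex, ey]; ring
  have e0 : x 0 = y 0 := by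
    have : (x 0 - y 0) ^ 2 = 0 := by
      nlinarith [sq_nonneg (x 0 - y 0), sq_nonneg (x 1 - y 1), sq_nonneg (x 0 * y 1 - x 1 * y 0)]
    exact sub_eq_zero.1 (pow_eq_zero_iff two_ne_zero |>.1 this)
  have e1 : x 1 = y 1 := by
    have : (x 1 - y 1) ^ 2 = 0 := by
      nlinarith [sq_nonneg (x 0 - y 0), sq_nonneg (x 1 - y 1), sq_nonneg (x 0 * y 1 - x 1 * y 0)]
    exact sub_eq_zero.1 (pow_eq_zero_iff two_ne_zero |>.1 this)
  have e2 : x 2 = y 2 := by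
    have : (x 2) ^ 2 = (y 2) ^ 2 := by rw [e0, e1] at hx; linarith
    exact (pow_left_inj₀ hx2.le hy2.le two_ne_zero).1 this
  ext i
  fin_cases i
  exacts [e0, e1, e2]

/-- Multiplied by `(n 2) ^ 2`, the value `form w w` becomes a sum of squares. This makes each face
plane Euclidean. -/
theorem form_self_pos {n w : Mink} (hn : n ∈ hyp) (hw : form w n = 0) (hw0 : w ≠ 0) :
    0 < form w w := by
  obtain ⟨hn, hn2⟩ := hn
  unfold form at *
  have key : (w 0 * w 0 + w 1 * w 1 - w 2 * w 2) * (n 2) ^ 2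
      = w 0 ^ 2 + w 1 ^ 2 + (w 0 * n 1 - w 1 * n 0) ^ 2 := by
    linear_combination (-(w 2 * n 2) - w 0 * n 0 - w 1 * n 1) * (-hw) - (w 0 ^ 2 + w 1 ^ 2) * hn
  have hn2' : 0 < (n 2) ^ 2 := by positivity
  refine pos_of_mul_pos_left (b := (n 2) ^ 2) ?_ hn2'.le
  rw [key]
  by_contra! hle
  have e0 : w 0 = 0 := by
    have : w 0 ^ 2 = 0 := by
      nlinarith [sq_nonneg (w 0), sq_nonneg (w 1), sq_nonneg (w 0 * n 1 - w 1 * n 0)]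
    exact pow_eq_zero_iff two_ne_zero |>.1 this
  have e1 : w 1 = 0 := by
    have : w 1 ^ 2 = 0 := by
      nlinarith [sq_nonneg (w 0), sq_nonneg (w 1), sq_nonneg (w 0 * n 1 - w 1 * n 0)]
    exact pow_eq_zero_iff two_ne_zero |>.1 this
  have e2 : w 2 = 0 := by
    rw [e0, e1] at hw
    have : w 2 * n 2 = 0 := by linarith
    exact (mul_eq_zero.1 this).resolve_right hn2.ne'
  refine hw0 (funext fun i => ?_)
  fin_cases i
  exacts [e0, e1, e2]

/-- The norm of the space component of a vector of Minkowski space. -/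
noncomputable def spaceNorm (x : Mink) : ℝ := √(x 0 ^ 2 + x 1 ^ 2)

theorem spaceNorm_nonneg (x : Mink) : 0 ≤ spaceNorm x := Real.sqrt_nonneg _

theorem spaceNorm_sq (x : Mink) : spaceNorm x ^ 2 = x 0 ^ 2 + x 1 ^ 2 :=
  Real.sq_sqrt (by positivity)

theorem spaceNorm_lt {n : Mink} (hn : n ∈ hyp) : spaceNorm n < n 2 := by
  obtain ⟨hn, hn2⟩ := hn
  refine lt_of_pow_lt_pow_left₀ 2 hn2.le ?_
  rw [spaceNorm_sq]
  unfold form at hn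
  linarith

theorem abs_apply_zero_le (x : Mink) : |x 0| ≤ spaceNorm x :=
  Real.abs_le_sqrt (by nlinarith [sq_nonneg (x 1)])

theorem abs_apply_one_le (x : Mink) : |x 1| ≤ spaceNorm x :=
  Real.abs_le_sqrt (by nlinarith [sq_nonneg (x 0)])

/-- A quantitative form of the fact that two future vectors have negative product. -/
theorem mul_le_neg_form (x : Mink) {y : Mink} (hy : spaceNorm y ≤ y 2) :
    (x 2 - spaceNorm x) * y 2 ≤ -form x y := by
  have h1 : x 0 * y 0 + x 1 * y 1 ≤ spaceNorm x * spaceNorm y := by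
    refine le_trans (le_abs_self _) (abs_le_of_sq_le_sq ?_
      (mul_nonneg (spaceNorm_nonneg _) (spaceNorm_nonneg _)))
    rw [mul_pow, spaceNorm_sq, spaceNorm_sq]
    nlinarith [sq_nonneg (x 0 * y 1 - x 1 * y 0)]
  have h2 : spaceNorm x * spaceNorm y ≤ spaceNorm x * y 2 :=
    mul_le_mul_of_nonneg_left hy (spaceNorm_nonneg _)
  unfold form
  linarith

theorem form_le_mul (w : Mink) {n : Mink} (hn : spaceNorm n ≤ n 2) :
    form w n ≤ (|w 0| + |w 1| + |w 2|) * n 2 := by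
  have h0 := (abs_apply_zero_le n).trans hn
  have h1 := (abs_apply_one_le n).trans hn
  have h2 : 0 ≤ n 2 := (spaceNorm_nonneg _).trans hn
  have e0 : w 0 * n 0 ≤ |w 0| * n 2 :=
    (le_abs_self _).trans (by rw [abs_mul]; gcongr)
  have e1 : w 1 * n 1 ≤ |w 1| * n 2 :=
    (le_abs_self _).trans (by rw [abs_mul]; gcongr)
  have e2 : -(w 2) * n 2 ≤ |w 2| * n 2 := by gcongr; exact neg_le_abs _
  unfold form
  linarith

theorem isCompact_hyp_inter (R : ℝ) : IsCompact (hyp ∩ {x | x 2 ≤ R}) := by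
  have hcl : IsClosed ({x : Mink | form x x = -1} ∩ {x | 0 ≤ x 2} ∩ {x | x 2 ≤ R}) := by
    refine (IsClosed.inter ?_ ?_).inter ?_
    · exact isClosed_eq (by unfold form; fun_prop) continuous_const
    · exact isClosed_le continuous_const (continuous_apply 2)
    · exact isClosed_le (continuous_apply 2) continuous_const
  have heq : hyp ∩ {x | x 2 ≤ R}
      = {x : Mink | form x x = -1} ∩ {x | 0 ≤ x 2} ∩ {x | x 2 ≤ R} := by
    ext x
    simp only [hyp, Set.mem_inter_iff, Set.mem_ofPred_eq]
    refine and_congr_left fun _ => and_congr_right fun hx => ⟨le_of_lt, fun h => ?_⟩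
    refine lt_of_le_of_ne h fun h0 => ?_
    unfold form at hx
    rw [← h0] at hx
    nlinarith [mul_self_nonneg (x 0), mul_self_nonneg (x 1)]
  refine IsCompact.of_isClosed_subset (isCompact_Icc (a := fun _ : Fin 3 => -R) (b := fun _ => R))
    (heq ▸ hcl) ?_
  rintro x ⟨hx, hxR⟩
  have h := (spaceNorm_lt hx).le.trans hxR
  have h0 := abs_le.1 ((abs_apply_zero_le x).trans h)
  have h1 := abs_le.1 ((abs_apply_one_le x).trans h)
  have h2 := hx.2
  have hR : x 2 ≤ R := hxR
  refine ⟨fun i => ?_, fun i => ?_⟩ <;> fin_cases i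
  exacts [h0.1, h1.1, by change -R ≤ x 2; linarith, h0.2, h1.2, hR]

end Form

/-! ### Local finiteness, compact faces, and rays inside a face -/

section Polyhedron

variable {Γ : Subgroup (Mink ≃ₗ[ℝ] Mink)} {m : ℕ} {u : Fin m → Mink} {h : Fin m → ℝ}

theorem normal_mem_hyp (hΓ : IsFuchsianGroup Γ) (hP : IsConvexPolyhedron Γ u h) (a : Label Γ m) :
    normal u a ∈ hyp :=
  hΓ.map_hyp _ a.1.2 _ (hP.normal_mem _)

theorem normal_injective (hΓ : IsFuchsianGroup Γ) (hP : IsConvexPolyhedron Γ u h) :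
    Function.Injective (normal u : Label Γ m → Mink) := by
  rintro ⟨γ, i⟩ ⟨δ, j⟩ hab
  have hab' : (γ : Mink ≃ₗ[ℝ] Mink) (u i) = (δ : Mink ≃ₗ[ℝ] Mink) (u j) := hab
  have h1 : ((δ⁻¹ * γ : Γ) : Mink ≃ₗ[ℝ] Mink) (u i) = u j := by
    have : ((δ⁻¹ * γ : Γ) : Mink ≃ₗ[ℝ] Mink) (u i)
      = (δ : Mink ≃ₗ[ℝ] Mink).symm ((γ : Mink ≃ₗ[ℝ] Mink) (u i)) := rfl
    rw [this, hab', LinearEquiv.symm_apply_apply]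
  obtain rfl := hP.orbits_distinct i j _ (δ⁻¹ * γ).2 h1
  have h2 : δ⁻¹ * γ = 1 := Subtype.ext (hΓ.free _ (δ⁻¹ * γ).2 _ (hP.normal_mem i) h1)
  rw [inv_mul_eq_one] at h2
  rw [h2]

/-- Proper discontinuity is applied to a compact piece of `ℍ²` high enough to contain all the `uᵢ`
as well as the normals in question. -/
theorem finite_normal_le (hΓ : IsFuchsianGroup Γ) (hP : IsConvexPolyhedron Γ u h) (R : ℝ) :
    {b : Label Γ m | normal u b 2 ≤ R}.Finite := by
  obtain ⟨M, hM⟩ : ∃ M, ∀ i, u i 2 ≤ M := by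
    obtain ⟨M, hM⟩ := (Set.finite_range fun i => u i 2).bddAbove
    exact ⟨M, fun i => hM ⟨i, rfl⟩⟩
  have hfin := hΓ.properlyDiscontinuous (hyp ∩ {x | x 2 ≤ max R M}) Set.inter_subset_left
    (isCompact_hyp_inter _)
  have hfin' := (hfin.preimage (f := fun γ : Γ => (γ : Mink ≃ₗ[ℝ] Mink))
    Subtype.val_injective.injOn).prod (Set.finite_univ (α := Fin m))
  refine hfin'.subset fun b hb => ⟨⟨b.1.2, ?_⟩, Set.mem_univ _⟩
  refine ⟨normal u b, ⟨u b.2, ⟨hP.normal_mem _, (hM _).trans (le_max_right _ _)⟩, rfl⟩,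
    normal_mem_hyp hΓ hP b, ?_⟩
  have hb' : normal u b 2 ≤ R := hb
  exact hb'.trans (le_max_left _ _)

/-- By cocompactness each orbit of normals is coarsely dense in `ℍ²`. -/
theorem exists_label_neg_form_le (hΓ : IsFuchsianGroup Γ) (u : Fin m → Mink)
    (i : Fin m) : ∃ C, 0 ≤ C ∧ ∀ y ∈ hyp, ∃ b : Label Γ m, b.2 = i ∧ -form (normal u b) y ≤ C := by
  obtain ⟨K, hK, hKc, hcov⟩ := hΓ.cocompact
  obtain ⟨C, hC⟩ := hKc.bddAbove_image
    (f := fun x => -form x (u i)) (continuous_form_left (u i)).neg.continuousOn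
  refine ⟨max C 0, le_max_right _ _, fun y hy => ?_⟩
  obtain ⟨γ, hγ, hγy⟩ := hcov y hy
  refine ⟨(⟨γ, hγ⟩⁻¹, i), rfl, le_trans ?_ (le_max_left _ _)⟩
  have h1 : -form (γ y) (u i) ≤ C := hC ⟨γ y, hγy, rfl⟩
  have h2 : γ (normal u ((⟨γ, hγ⟩⁻¹, i) : Label Γ m)) = u i := γ.apply_symm_apply (u i)
  rwa [← hΓ.isometry γ hγ, h2, form_comm]

/-- A convex `Γ`-polyhedron lies in the open future cone. -/
theorem spaceNorm_lt_of_mem_polyhedron (hΓ : IsFuchsianGroup Γ) (hP : IsConvexPolyhedron Γ u h)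
    (i : Fin m) {x : Mink} (hx : x ∈ polyhedron Γ u h) : spaceNorm x < x 2 := by
  by_contra! hle
  obtain ⟨C, hC0, hC⟩ := exists_label_neg_form_le hΓ u i
  obtain ⟨e₀, e₁, he, hx0, hx1⟩ : ∃ e₀ e₁ : ℝ, e₀ ^ 2 + e₁ ^ 2 = 1 ∧ x 0 = spaceNorm x * e₀ ∧
      x 1 = spaceNorm x * e₁ := by
    have hsq := spaceNorm_sq x
    rcases eq_or_ne (spaceNorm x) 0 with h0 | h0
    · refine ⟨1, 0, by norm_num, ?_, ?_⟩
      · have := abs_apply_zero_le x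
        rw [h0, abs_nonpos_iff] at this
        rw [this, h0, zero_mul]
      · have := abs_apply_one_le x
        rw [h0, abs_nonpos_iff] at this
        rw [this, mul_zero]
    · refine ⟨x 0 / spaceNorm x, x 1 / spaceNorm x, ?_, by field_simp, by field_simp⟩
      field_simp
      linarith
  set ρ := spaceNorm x
  have hi := hP.support_pos i
  -- If `x` is outside the open cone, take a point of `ℍ²` far out in the spatial direction `(e₀,
  -- e₁)` of `x`: in null coordinates it is `(2 * s, 1 / (2 * s))`. A normal `z` of the orbit near
  -- it has `z 2 - p ≤ C / s`, and its half-space forces `h ≤ |ρ + x 2| * (z 2 - p)`. The value of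
  -- `s` makes these incompatible.
  set s := (|ρ + x 2| * C + 1) / h i with hs
  have hs0 : 0 < s := by positivity
  have hy : ![(s - 1 / (4 * s)) * e₀, (s - 1 / (4 * s)) * e₁, s + 1 / (4 * s)] ∈ hyp := by
    refine ⟨?_, by change 0 < s + 1 / (4 * s); positivity⟩
    simp only [form, Matrix.cons_val_zero, Matrix.cons_val_one, Matrix.cons_val]
    have : (s - 1 / (4 * s)) ^ 2 - (s + 1 / (4 * s)) ^ 2 = -1 := by field_simp; ring
    linear_combination (s - 1 / (4 * s)) ^ 2 * he + this
  obtain ⟨b, rfl, hb⟩ := hC _ hy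
  have hz := normal_mem_hyp hΓ hP b
  have hzlt := spaceNorm_lt hz
  have hxb := hx b
  set z := normal u b
  set p := z 0 * e₀ + z 1 * e₁ with hp
  have hpz : |p| ≤ spaceNorm z := by
    refine Real.abs_le_sqrt ?_
    have : (z 0 ^ 2 + z 1 ^ 2) * (e₀ ^ 2 + e₁ ^ 2) = p ^ 2 + (z 0 * e₁ - z 1 * e₀) ^ 2 := by
      rw [hp]; ring
    rw [he] at this
    nlinarith [sq_nonneg (z 0 * e₁ - z 1 * e₀)]
  obtain ⟨hp1, hp2⟩ := abs_le.1 hpz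
  have hA : 0 < z 2 - p := by linarith
  have hA' : 0 < z 2 + p := by linarith
  have h1 : s * (z 2 - p) ≤ C := by
    have : -form z ![(s - 1 / (4 * s)) * e₀, (s - 1 / (4 * s)) * e₁, s + 1 / (4 * s)]
        = s * (z 2 - p) + 1 / (4 * s) * (z 2 + p) := by
      simp only [form, Matrix.cons_val_zero, Matrix.cons_val_one, Matrix.cons_val, hp]
      ring
    rw [this] at hb
    have : 0 < 1 / (4 * s) * (z 2 + p) := by positivity
    linarith
  have h2 : h b.2 ≤ |ρ + x 2| * (z 2 - p) := by
    have e : form x z = ρ * p - x 2 * z 2 := by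
      unfold form; rw [hx0, hx1, hp]; ring
    rw [e] at hxb
    have h3 : 2 * h b.2 ≤ (ρ + x 2) * (z 2 - p) - (ρ - x 2) * (z 2 + p) := by linarith
    have h4 : 0 ≤ (ρ - x 2) * (z 2 + p) := mul_nonneg (by linarith) hA'.le
    have h5 : (ρ + x 2) * (z 2 - p) ≤ |ρ + x 2| * (z 2 - p) := by gcongr; exact le_abs_self _
    linarith
  have h3 : h b.2 * s ≤ |ρ + x 2| * C := by
    calc h b.2 * s ≤ |ρ + x 2| * (z 2 - p) * s := by gcongr
      _ = |ρ + x 2| * (s * (z 2 - p)) := by ring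
      _ ≤ _ := by gcongr
  have h4 : h b.2 * s = |ρ + x 2| * C + 1 := by rw [hs]; field_simp
  linarith

theorem isClosed_face (a : Label Γ m) : IsClosed (face u h a) := by
  refine IsClosed.inter ?_ (isClosed_eq (continuous_form_left _) continuous_const)
  simp only [polyhedron, Set.ofPred_forall]
  exact isClosed_iInter fun b => isClosed_le (continuous_form_left _) continuous_const

theorem isCompact_face (hΓ : IsFuchsianGroup Γ) (hP : IsConvexPolyhedron Γ u h) (a : Label Γ m) :
    IsCompact (face u h a) := by
  have hn := normal_mem_hyp hΓ hP a
  have hpos : 0 < normal u a 2 - spaceNorm (normal u a) := sub_pos.2 (spaceNorm_lt hn)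
  set M := h a.2 / (normal u a 2 - spaceNorm (normal u a)) with hM
  refine IsCompact.of_isClosed_subset (isCompact_Icc (a := fun _ : Fin 3 => -M) (b := fun _ => M))
    (isClosed_face a) fun x hx => ?_
  have hlt := spaceNorm_lt_of_mem_polyhedron hΓ hP a.2 hx.1
  have h1 := mul_le_neg_form (normal u a) hlt.le
  rw [form_comm, hx.2, neg_neg] at h1
  have h2 : x 2 ≤ M := by rw [hM, le_div_iff₀ hpos]; linarith
  have h0 := spaceNorm_nonneg x
  have h3 := abs_le.1 ((abs_apply_zero_le x).trans (hlt.le.trans h2))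
  have h4 := abs_le.1 ((abs_apply_one_le x).trans (hlt.le.trans h2))
  refine ⟨fun i => ?_, fun i => ?_⟩ <;> fin_cases i
  exacts [h3.1, h4.1, by change -M ≤ x 2; linarith, h3.2, h4.2, h2]

/-- On the compact face, `x 2 - spaceNorm x` has a positive minimum, which bounds the height of the
normal of any face through one of its points. -/
theorem finite_faces_meeting (hΓ : IsFuchsianGroup Γ) (hP : IsConvexPolyhedron Γ u h)
    (a : Label Γ m) : {b : Label Γ m | (face u h a ∩ face u h b).Nonempty}.Finite := by
  rcases (face u h a).eq_empty_or_nonempty with he | hne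
  · simp [he]
  have hcont : Continuous fun x : Mink => x 2 - spaceNorm x := by unfold spaceNorm; fun_prop
  obtain ⟨x₀, hx₀, hmin⟩ := (isCompact_face hΓ hP a).exists_isMinOn hne hcont.continuousOn
  have hc : 0 < x₀ 2 - spaceNorm x₀ :=
    sub_pos.2 (spaceNorm_lt_of_mem_polyhedron hΓ hP a.2 hx₀.1)
  obtain ⟨M, hM⟩ := (Set.finite_range h).bddAbove
  refine (finite_normal_le hΓ hP (M / (x₀ 2 - spaceNorm x₀))).subset ?_
  rintro b ⟨x, hxa, hxb⟩
  have hn := normal_mem_hyp hΓ hP b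
  have h1 := mul_le_neg_form x (spaceNorm_lt hn).le
  rw [hxb.2, neg_neg] at h1
  have h2 : x₀ 2 - spaceNorm x₀ ≤ x 2 - spaceNorm x := hmin hxa
  have h3 : h b.2 ≤ M := hM ⟨b.2, rfl⟩
  have h4 := hn.2
  change normal u b 2 ≤ _
  rw [le_div_iff₀ hc]
  nlinarith

/-- A direction which does not leave any of the half-spaces active at a point of the polyhedron is
tangent to the polyhedron. -/
theorem exists_pos_add_smul_mem (hΓ : IsFuchsianGroup Γ) (hP : IsConvexPolyhedron Γ u h)
    (i : Fin m) {x w : Mink} (hx : x ∈ polyhedron Γ u h)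
    (hw : ∀ c : Label Γ m, form x (normal u c) = -h c.2 → form w (normal u c) ≤ 0) :
    ∃ ε : ℝ, 0 < ε ∧ x + ε • w ∈ polyhedron Γ u h := by
  have hc : 0 < x 2 - spaceNorm x := sub_pos.2 (spaceNorm_lt_of_mem_polyhedron hΓ hP i hx)
  set c := x 2 - spaceNorm x
  set W := |w 0| + |w 1| + |w 2| with hW
  have hW0 : 0 ≤ W := by positivity
  obtain ⟨M, hM⟩ := (Set.finite_range h).bddAbove
  -- Finitely many low normals are treated one by one. For the others, `ε * W ≤ c / 2` leaves a
  -- margin of `c / 2 * normal u b 2 > M`, uniformly in `b`.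
  have hfin := finite_normal_le hΓ hP (2 * M / c)
  have hfar : ∀ᶠ ε : ℝ in 𝓝[>] 0, ε * W ≤ c / 2 := by
    have : Tendsto (fun ε : ℝ => ε * W) (𝓝[>] 0) (𝓝 0) := by
      have : Tendsto (fun ε : ℝ => ε * W) (𝓝 0) (𝓝 (0 * W)) :=
        (continuous_id.mul continuous_const).tendsto _
      rw [zero_mul] at this
      exact this.mono_left nhdsWithin_le_nhds
    exact this.eventually_le_const (by positivity)
  have hnear : ∀ᶠ ε : ℝ in 𝓝[>] 0, ∀ b ∈ {b : Label Γ m | normal u b 2 ≤ 2 * M / c},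
      form (x + ε • w) (normal u b) ≤ -h b.2 := by
    refine (eventually_all_finite hfin).2 fun b _ => ?_
    rcases (hx b).eq_or_lt with heq | hlt
    · filter_upwards [self_mem_nhdsWithin] with ε hε
      have hε : 0 < ε := hε
      rw [form_add_left, form_smul_left, heq]
      nlinarith [hw b heq]
    · have : Tendsto (fun ε : ℝ => form (x + ε • w) (normal u b)) (𝓝[>] 0)
          (𝓝 (form (x + (0 : ℝ) • w) (normal u b))) := by
        have hcont : Continuous fun ε : ℝ => form (x + ε • w) (normal u b) :=
          (continuous_form_left _).comp (by fun_prop)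
        exact (hcont.tendsto 0).mono_left nhdsWithin_le_nhds
      rw [zero_smul, add_zero] at this
      exact this.eventually_le_const hlt
  obtain ⟨ε, ⟨h1, h2⟩, hε⟩ := ((hfar.and hnear).and self_mem_nhdsWithin).exists
  have hε : 0 < ε := hε
  refine ⟨ε, hε, fun b => ?_⟩
  by_cases hb : normal u b 2 ≤ 2 * M / c
  · exact h2 b hb
  · rw [not_le, div_lt_iff₀ hc] at hb
    have hn := normal_mem_hyp hΓ hP b
    have hn2 := hn.2
    have h3 := mul_le_neg_form x (spaceNorm_lt hn).le
    have h4 := form_le_mul w (spaceNorm_lt hn).le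
    have h5 : h b.2 ≤ M := hM ⟨b.2, rfl⟩
    rw [form_add_left, form_smul_left]
    have h6 : ε * form w (normal u b) ≤ c / 2 * normal u b 2 := by
      calc ε * form w (normal u b) ≤ ε * (W * normal u b 2) := by gcongr
        _ = ε * W * normal u b 2 := by ring
        _ ≤ _ := by gcongr
    linarith

/-- A ray in the plane of a face, starting in that face, leaves it through another face. -/
theorem exists_exit (hΓ : IsFuchsianGroup Γ) (hP : IsConvexPolyhedron Γ u h) {a : Label Γ m}
    {x w : Mink} (hx : x ∈ face u h a) (hw : form w (normal u a) = 0) (hw0 : w ≠ 0) :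
    ∃ t : ℝ, 0 ≤ t ∧ x + t • w ∈ face u h a ∧
      ∃ c : Label Γ m, x + t • w ∈ face u h c ∧ 0 < form w (normal u c) := by
  set T : Set ℝ := {t | 0 ≤ t ∧ x + t • w ∈ face u h a} with hT
  have h0 : (0 : ℝ) ∈ T := ⟨le_rfl, by simpa using hx⟩
  have hTc : IsCompact T := by
    obtain ⟨M, hM⟩ := (isCompact_face hΓ hP a).isBounded.exists_norm_le
    refine Metric.isCompact_of_isClosed_isBounded ?_ ?_
    · refine isClosed_Ici.inter ((isClosed_face a).preimage ?_)
      fun_prop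
    · refine (Metric.isBounded_Icc 0 ((M + ‖x‖) / ‖w‖)).subset fun t ht => ⟨ht.1, ?_⟩
      rw [le_div_iff₀ (norm_pos_iff.2 hw0)]
      calc t * ‖w‖ = ‖(x + t • w) - x‖ := by
            rw [add_sub_cancel_left, norm_smul, Real.norm_of_nonneg ht.1]
        _ ≤ ‖x + t • w‖ + ‖x‖ := norm_sub_le _ _
        _ ≤ _ := by gcongr; exact hM _ ht.2
  obtain ⟨t, ht, hmax⟩ := hTc.exists_isMaxOn ⟨0, h0⟩ continuousOn_id
  refine ⟨t, ht.1, ht.2, ?_⟩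
  -- At the last parameter, if no active constraint increased along `w`, the ray could be prolonged
  -- inside the face.
  by_contra! hno
  obtain ⟨ε, hε, hmem⟩ := exists_pos_add_smul_mem hΓ hP a.2 (x := x + t • w) (w := w) ht.2.1
    fun c hc => hno c ⟨ht.2.1, hc⟩
  have : t + ε ∈ T := by
    refine ⟨by linarith [ht.1], ?_⟩
    rw [add_smul, ← add_assoc]
    refine ⟨hmem, ?_⟩
    rw [form_add_left, ht.2.2, form_smul_left, hw, mul_zero, add_zero]
  have h1 : t + ε ≤ t := hmax this
  linarith

/-- A two-dimensional face is not contained in a line; `d = 0` is allowed and yields a point other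
than `x`. -/
theorem exists_sub_ne_smul (hP : IsConvexPolyhedron Γ u h) (a : Label Γ m) (x d : Mink) :
    ∃ z ∈ face u h a, ∀ t : ℝ, z - x ≠ t • d := by
  by_contra! hcon
  have hle : vectorSpan ℝ (face u h a) ≤ Submodule.span ℝ {d} := by
    rw [vectorSpan_def, Submodule.span_le]
    rintro _ ⟨y, hy, z, hz, rfl⟩
    obtain ⟨s, hs⟩ := hcon y hy
    obtain ⟨t, ht⟩ := hcon z hz
    refine Submodule.mem_span_singleton.2 ⟨s - t, ?_⟩
    rw [sub_smul, ← hs, ← ht]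
    simp
  have h1 := Submodule.finrank_mono hle
  rw [hP.face_dim a] at h1
  have h2 := h1.trans (finrank_span_le_card (R := ℝ) ({d} : Set Mink))
  simp at h2

end Polyhedron

/-! ### Edges of a face, their endpoints and their lengths -/

section Edges

variable {Γ : Subgroup (Mink ≃ₗ[ℝ] Mink)} {m : ℕ} {u : Fin m → Mink} {h : Fin m → ℝ}

theorem one_lt_neg_form_normal (hΓ : IsFuchsianGroup Γ) (hP : IsConvexPolyhedron Γ u h)
    {a b : Label Γ m} (hab : a ≠ b) : 1 < -form (normal u a) (normal u b) :=
  one_lt_neg_form (normal_mem_hyp hΓ hP a) (normal_mem_hyp hΓ hP b)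
    ((normal_injective hΓ hP).ne hab)

theorem cosh_phi (hΓ : IsFuchsianGroup Γ) (hP : IsConvexPolyhedron Γ u h)
    {a b : Label Γ m} (hab : a ≠ b) :
    Real.cosh (phi u a b) = -form (normal u a) (normal u b) :=
  Real.cosh_arcosh (one_lt_neg_form_normal hΓ hP hab).le

theorem sinh_phi_pos (hΓ : IsFuchsianGroup Γ) (hP : IsConvexPolyhedron Γ u h)
    {a b : Label Γ m} (hab : a ≠ b) : 0 < Real.sinh (phi u a b) :=
  Real.sinh_pos_iff.2 (Real.arcosh_pos (one_lt_neg_form_normal hΓ hP hab))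

theorem normal_eq_edgeNormal (hΓ : IsFuchsianGroup Γ) (hP : IsConvexPolyhedron Γ u h)
    {a b : Label Γ m} (hab : a ≠ b) :
    normal u b = Real.sinh (phi u a b) • edgeNormal u a b
      + Real.cosh (phi u a b) • normal u a := by
  rw [edgeNormal, smul_inv_smul₀ (sinh_phi_pos hΓ hP hab).ne', sub_add_cancel]

theorem form_normal_edgeNormal (hΓ : IsFuchsianGroup Γ) (hP : IsConvexPolyhedron Γ u h)
    {a b : Label Γ m} (hab : a ≠ b) : form (normal u a) (edgeNormal u a b) = 0 := by
  have ha := (normal_mem_hyp hΓ hP a).1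
  rw [edgeNormal, form_smul_right, form_sub_right, form_smul_right, cosh_phi hΓ hP hab, ha]
  ring

theorem form_edgeNormal_self (hΓ : IsFuchsianGroup Γ) (hP : IsConvexPolyhedron Γ u h)
    {a b : Label Γ m} (hab : a ≠ b) : form (edgeNormal u a b) (edgeNormal u a b) = 1 := by
  have ha := (normal_mem_hyp hΓ hP a).1
  have hb := (normal_mem_hyp hΓ hP b).1
  have hs := (sinh_phi_pos hΓ hP hab).ne'
  have h1 : form (normal u b - Real.cosh (phi u a b) • normal u a)
      (normal u b - Real.cosh (phi u a b) • normal u a) = Real.sinh (phi u a b) ^ 2 := by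
    rw [Real.sinh_sq, cosh_phi hΓ hP hab]
    simp only [form_sub_left, form_sub_right, form_smul_left, form_smul_right, ha, hb,
      form_comm (normal u b) (normal u a)]
    ring
  rw [edgeNormal, form_smul_left, form_smul_right, h1]
  field_simp

theorem form_edgeNormal (hΓ : IsFuchsianGroup Γ) (hP : IsConvexPolyhedron Γ u h)
    {a b : Label Γ m} (hab : a ≠ b) {x : Mink} (hxa : form x (normal u a) = -h a.2)
    (hxb : form x (normal u b) = -h b.2) : form x (edgeNormal u a b) = edgeSupport u h a b := by
  have hs := (sinh_phi_pos hΓ hP hab).ne'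
  rw [edgeNormal, form_smul_right, form_sub_right, form_smul_right, hxa, hxb, edgeSupport]
  field_simp
  ring

theorem form_edgeNormal_eq_zero {a b : Label Γ m} {x : Mink} (hxa : form x (normal u a) = 0)
    (hxb : form x (normal u b) = 0) : form x (edgeNormal u a b) = 0 := by
  rw [edgeNormal, form_smul_right, form_sub_right, form_smul_right, hxa, hxb]
  ring

/-- A unit vector directing the common line of the planes `a` and `b`. -/
structure IsEdgeDir (u : Fin m → Mink) (a b : Label Γ m) (d : Mink) : Prop where
  ne : a ≠ b
  unit : form d d = 1
  left : form d (normal u a) = 0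
  right : form d (normal u b) = 0

theorem IsEdgeDir.neg {a b : Label Γ m} {d : Mink} (hd : IsEdgeDir u a b d) :
    IsEdgeDir u a b (-d) :=
  ⟨hd.ne, by rw [form_neg_left, form_neg_right, neg_neg, hd.unit],
    by rw [form_neg_left, hd.left, neg_zero], by rw [form_neg_left, hd.right, neg_zero]⟩

theorem IsEdgeDir.expansion (hΓ : IsFuchsianGroup Γ) (hP : IsConvexPolyhedron Γ u h)
    {a b : Label Γ m} {d : Mink} (hd : IsEdgeDir u a b d) (x : Mink) :
    x = -form x (normal u a) • normal u a + form x (edgeNormal u a b) • edgeNormal u a b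
      + form x d • d :=
  eq_orthonormal_expansion (normal_mem_hyp hΓ hP a).1 (form_edgeNormal_self hΓ hP hd.ne) hd.unit
    (form_normal_edgeNormal hΓ hP hd.ne) (form_comm d _ ▸ hd.left)
    (form_comm d _ ▸ form_edgeNormal_eq_zero hd.left hd.right) x

theorem IsEdgeDir.eq_smul (hΓ : IsFuchsianGroup Γ) (hP : IsConvexPolyhedron Γ u h)
    {a b : Label Γ m} {d : Mink} (hd : IsEdgeDir u a b d) {x : Mink}
    (hxa : form x (normal u a) = 0) (hxb : form x (normal u b) = 0) : x = form x d • d := by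
  have := hd.expansion hΓ hP x
  rwa [hxa, form_edgeNormal_eq_zero hxa hxb, neg_zero, zero_smul, zero_smul, zero_add,
    zero_add] at this

theorem exists_isEdgeDir (hΓ : IsFuchsianGroup Γ) (hP : IsConvexPolyhedron Γ u h)
    {a b : Label Γ m} (hab : a ≠ b) {w : Mink} (hw : w ≠ 0) (hwa : form w (normal u a) = 0)
    (hwb : form w (normal u b) = 0) :
    ∃ d, IsEdgeDir u a b d ∧ ∃ t : ℝ, 0 < t ∧ w = t • d := by
  have hpos := form_self_pos (normal_mem_hyp hΓ hP a) hwa hw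
  have hs : 0 < √(form w w) := Real.sqrt_pos.2 hpos
  refine ⟨(√(form w w))⁻¹ • w, ⟨hab, ?_, ?_, ?_⟩, √(form w w), hs, ?_⟩
  · rw [form_smul_left, form_smul_right, ← mul_assoc, ← mul_inv, Real.mul_self_sqrt hpos.le,
      inv_mul_cancel₀ hpos.ne']
  · rw [form_smul_left, hwa, mul_zero]
  · rw [form_smul_left, hwb, mul_zero]
  · rw [smul_inv_smul₀ hs.ne']

/-- A face whose normal is a positive combination of the normals of two others cannot contain a
point which is common to these. -/
theorem normal_ne_pos_combination (hΓ : IsFuchsianGroup Γ) (hP : IsConvexPolyhedron Γ u h)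
    {a b c : Label Γ m} {d : Mink} (hd : IsEdgeDir u a b d) {α β : ℝ} (hα : 0 < α) (hβ : 0 < β)
    (hc : normal u c = α • normal u a + β • normal u b) {x : Mink} (hxa : x ∈ face u h a)
    (hxb : x ∈ face u h b) (hxc : x ∈ face u h c) : False := by
  -- Both terms of the positive combination are maximal at `x`, so equality of the sums at `z`
  -- forces `z - x` onto the line of `d`.
  obtain ⟨z, hz, hzd⟩ := exists_sub_ne_smul hP c x d
  have h1 : form x (normal u c) = form z (normal u c) := by rw [hz.2, hxc.2]
  simp only [hc, form_add_right, form_smul_right] at h1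
  have ha : form z (normal u a) ≤ form x (normal u a) := hxa.2 ▸ hz.1 a
  have hb : form z (normal u b) ≤ form x (normal u b) := hxb.2 ▸ hz.1 b
  refine hzd _ (hd.eq_smul hΓ hP ?_ ?_) <;> rw [form_sub_left] <;> nlinarith

/-- Three different planes bounding the polyhedron cannot have a common edge. -/
theorem not_three_faces (hΓ : IsFuchsianGroup Γ) (hP : IsConvexPolyhedron Γ u h)
    {a b c : Label Γ m} (hab : a ≠ b) (hac : a ≠ c) (hbc : b ≠ c) {x y : Mink} (hxy : x ≠ y)
    (hxa : x ∈ face u h a) (hxb : x ∈ face u h b) (hxc : x ∈ face u h c)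
    (hya : y ∈ face u h a) (hyb : y ∈ face u h b) (hyc : y ∈ face u h c) : False := by
  have hw : ∀ {e : Label Γ m}, x ∈ face u h e → y ∈ face u h e → form (y - x) (normal u e) = 0 := by
    intro e hx hy
    rw [form_sub_left, hx.2, hy.2, sub_self]
  obtain ⟨d, hd, t, ht, hwd⟩ := exists_isEdgeDir hΓ hP hab (sub_ne_zero.2 hxy.symm) (hw hxa hya)
    (hw hxb hyb)
  have hdc : form d (normal u c) = 0 := by
    have := hw hxc hyc
    rw [hwd, form_smul_left] at this
    exact (mul_eq_zero.1 this).resolve_left ht.ne'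
  -- The three normals lie in the plane orthogonal to `d`. According to the signs of `α` and `β`,
  -- one normal is a positive combination of the other two or two normals coincide; two negative
  -- signs contradict the time component.
  obtain ⟨α, β, hc⟩ : ∃ α β : ℝ, normal u c = α • normal u a + β • normal u b := by
    have h1 := hd.expansion hΓ hP (normal u c)
    rw [form_comm _ d, hdc, zero_smul, add_zero] at h1
    generalize -form (normal u c) (normal u a) = α at h1
    generalize form (normal u c) (edgeNormal u a b) = β at h1
    refine ⟨α - β * (Real.sinh (phi u a b))⁻¹ * Real.cosh (phi u a b),
      β * (Real.sinh (phi u a b))⁻¹, ?_⟩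
    rw [h1, edgeNormal]
    module
  have hnc := normal_mem_hyp hΓ hP c
  have hna := normal_mem_hyp hΓ hP a
  have hnb := normal_mem_hyp hΓ hP b
  have hsmul : ∀ {e : Label Γ m} {s : ℝ}, normal u c = s • normal u e → e = c := by
    intro e s hs
    have hne := normal_mem_hyp hΓ hP e
    have h1 := hnc.1
    rw [hs, form_smul_left, form_smul_right, hne.1] at h1
    have h2 : 0 < s * normal u e 2 := by
      have := hnc.2
      rwa [hs, Pi.smul_apply, smul_eq_mul] at this
    have h3 : 0 < s := pos_of_mul_pos_left h2 hne.2.le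
    have h4 : s = 1 := by nlinarith
    rw [h4, one_smul] at hs
    exact (normal_injective hΓ hP hs).symm
  rcases lt_trichotomy α 0 with hα | rfl | hα
  · rcases lt_trichotomy β 0 with hβ | rfl | hβ
    · have h1 := hnc.2
      rw [hc, Pi.add_apply, Pi.smul_apply, Pi.smul_apply, smul_eq_mul, smul_eq_mul] at h1
      nlinarith [hna.2, hnb.2]
    · exact hac (hsmul (by simpa using hc))
    · have hd' : IsEdgeDir u a c d := ⟨hac, hd.unit, hd.left, hdc⟩
      refine normal_ne_pos_combination hΓ hP hd' (α := -α / β) (β := 1 / β)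
        (div_pos (neg_pos.2 hα) hβ) (by positivity) ?_ hxa hxc hxb
      rw [hc, smul_add, smul_smul, smul_smul, ← add_assoc, ← add_smul]
      have h1 : -α / β + 1 / β * α = 0 := by field_simp; ring
      have h2 : 1 / β * β = 1 := by field_simp
      rw [h1, h2, zero_smul, zero_add, one_smul]
  · exact hbc (hsmul (by simpa using hc))
  · rcases lt_trichotomy β 0 with hβ | rfl | hβ
    · have hd' : IsEdgeDir u b c d := ⟨hbc, hd.unit, hd.right, hdc⟩
      refine normal_ne_pos_combination hΓ hP hd' (α := -β / α) (β := 1 / α)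
        (div_pos (neg_pos.2 hβ) hα) (by positivity) ?_ hxb hxc hxa
      rw [hc, smul_add, smul_smul, smul_smul, add_comm (_ • normal u a), ← add_assoc, ← add_smul]
      have h1 : -β / α + 1 / α * β = 0 := by field_simp; ring
      have h2 : 1 / α * α = 1 := by field_simp
      rw [h1, h2, zero_smul, zero_add, one_smul]
    · exact hac (hsmul (by simpa using hc))
    · exact normal_ne_pos_combination hΓ hP hd hα hβ hc hxa hxb hxc

/-- At an endpoint of an edge, the partial length is the signed distance from the projection of the
origin. -/
theorem partialLength_eq (hΓ : IsFuchsianGroup Γ) (hP : IsConvexPolyhedron Γ u h)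
    {a b c : Label Γ m} {d : Mink} (hd : IsEdgeDir u a b d) (hdc : 0 < form d (normal u c))
    {q : Mink} (hqa : form q (normal u a) = -h a.2) (hqb : form q (normal u b) = -h b.2)
    (hqc : form q (normal u c) = -h c.2) : partialLength u h a b c = form q d := by
  have hac : a ≠ c := by
    rintro rfl
    exact hdc.ne' hd.left
  have hexp := hd.expansion hΓ hP (edgeNormal u a c)
  rw [form_comm _ (normal u a), form_normal_edgeNormal hΓ hP hac, neg_zero, zero_smul,
    zero_add] at hexp
  have hpos : 0 < form (edgeNormal u a c) d := by
    rw [form_comm, edgeNormal, form_smul_right, form_sub_right, form_smul_right, hd.left,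
      mul_zero, sub_zero]
    exact mul_pos (inv_pos.2 (sinh_phi_pos hΓ hP hac)) hdc
  set v := edgeNormal u a b
  set v' := edgeNormal u a c
  have hvd : form v d = 0 := form_comm d v ▸ form_edgeNormal_eq_zero hd.left hd.right
  have hdv : form d v = 0 := form_edgeNormal_eq_zero hd.left hd.right
  have hvv : form v v = 1 := form_edgeNormal_self hΓ hP hd.ne
  -- In the Euclidean plane of the face, `v' = cos ω • v + sin ω • d`, the sign of the sine being
  -- fixed by `hpos`.
  have hsq : form v v' ^ 2 + form v' d ^ 2 = 1 := by
    have h1 : form v' v' = 1 := form_edgeNormal_self hΓ hP hac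
    rw [hexp] at h1
    generalize form v' v = α at h1 hexp
    generalize form v' d = β at h1 hexp ⊢
    rw [hexp]
    simp only [form_add_left, form_add_right, form_smul_left, form_smul_right, hvd, hdv, hvv,
      hd.unit] at h1 ⊢
    linarith
  have hcos : Real.cos (omega u a b c) = form v v' :=
    Real.cos_arccos (by nlinarith) (by nlinarith)
  have hsin : Real.sin (omega u a b c) = form v' d := by
    rw [omega, Real.sin_arccos, show 1 - form v v' ^ 2 = form v' d ^ 2 by linarith,
      Real.sqrt_sq hpos.le]
  rw [partialLength, hcos, hsin, div_eq_iff hpos.ne', ← form_edgeNormal hΓ hP hd.ne hqa hqb,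
    ← form_edgeNormal hΓ hP hac hqa hqc]
  change form q v' - form q v * form v v' = _
  have h2 : form q v' = form v' v * form q v + form v' d * form q d := by
    conv_lhs => rw [hexp]
    rw [form_add_right, form_smul_right, form_smul_right]
  rw [h2, form_comm v' v]
  ring

/-- At an endpoint of an edge of a face exactly one further edge of this face begins. -/
theorem exists_unique_adjacent_edge (hΓ : IsFuchsianGroup Γ) (hP : IsConvexPolyhedron Γ u h)
    {a b : Label Γ m} {d : Mink} (hd : IsEdgeDir u a b d) {q : Mink} (hqa : q ∈ face u h a)
    (hqb : q ∈ face u h b) {t : ℝ} (ht : 0 < t) (hpa : q - t • d ∈ face u h a)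
    (hpb : q - t • d ∈ face u h b)
    (hexit : ∃ c : Label Γ m, q ∈ face u h c ∧ 0 < form d (normal u c)) :
    ∃ c ∈ neighbors u h a, c ≠ b ∧ q ∈ face u h c ∧ 0 < form d (normal u c) ∧
      ∀ c' ∈ neighbors u h a, c' ≠ b → q ∈ face u h c' → c' = c := by
  have hd0 : d ≠ 0 := by
    rintro rfl
    simpa [form] using hd.unit
  have hqp : q ≠ q - t • d := by
    intro heq
    exact smul_ne_zero ht.ne' hd0 (sub_eq_self.1 heq.symm)
  -- A face in `A` may touch the face `a` only at the vertex `q`. The plane with the smallest slope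
  -- `κ` is the one that cuts out the next edge, in direction `κ • d - v`.
  set A : Set (Label Γ m) := {c | q ∈ face u h c ∧ c ≠ a ∧ c ≠ b} with hA
  have hAfin : A.Finite := (finite_faces_meeting hΓ hP a).subset fun c hc => ⟨q, hqa, hc.1⟩
  have hApos : ∀ c ∈ A, 0 < form d (normal u c) := by
    rintro c ⟨hqc, hca, hcb⟩
    have h1 := hpa.1 c
    rw [form_sub_left, form_smul_left, hqc.2] at h1
    have h2 : 0 ≤ form d (normal u c) := by
      by_contra! hneg
      nlinarith
    refine h2.lt_of_ne fun h0 => ?_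
    refine not_three_faces hΓ hP hd.ne hca.symm hcb.symm hqp hqa hqb hqc hpa hpb ⟨hpa.1, ?_⟩
    rw [form_sub_left, form_smul_left, hqc.2, ← h0, mul_zero, sub_zero]
  have hAne : A.Nonempty := by
    obtain ⟨c, hqc, hc⟩ := hexit
    refine ⟨c, hqc, ?_, ?_⟩
    · rintro rfl; exact hc.ne' hd.left
    · rintro rfl; exact hc.ne' hd.right
  set v := edgeNormal u a b
  obtain ⟨c₀, hc₀, hmin⟩ := Set.exists_min_image A
    (fun c => form v (normal u c) / form d (normal u c)) hAfin hAne
  have hα₀ := hApos c₀ hc₀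
  set κ := form v (normal u c₀) / form d (normal u c₀) with hκ
  have hva : form v (normal u a) = 0 := form_comm _ v ▸ form_normal_edgeNormal hΓ hP hd.ne
  have hvb : form v (normal u b) = Real.sinh (phi u a b) := by
    rw [normal_eq_edgeNormal hΓ hP hd.ne, form_add_right, form_smul_right, form_smul_right, hva,
      form_edgeNormal_self hΓ hP hd.ne]
    ring
  have hsb := sinh_phi_pos hΓ hP hd.ne
  have hw₀ : ∀ e, form (κ • d - v) e = κ * form d e - form v e := fun e => by
    rw [form_sub_left, form_smul_left]
  have hw₀c : form (κ • d - v) (normal u c₀) = 0 := by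
    rw [hw₀, hκ]; field_simp; ring
  obtain ⟨ε, hε, hmem⟩ := exists_pos_add_smul_mem hΓ hP a.2 (x := q) (w := κ • d - v) hqa.1 (by
    intro c hc
    rw [hw₀]
    by_cases hca : c = a
    · rw [hca, hd.left, hva]; simp
    by_cases hcb : c = b
    · rw [hcb, hd.right, hvb]; simpa using hsb.le
    have hcA : c ∈ A := ⟨⟨hqa.1, hc⟩, hca, hcb⟩
    have h1 : κ ≤ form v (normal u c) / form d (normal u c) := hmin c hcA
    rw [le_div_iff₀ (hApos c hcA)] at h1
    linarith)
  have hface : ∀ {c : Label Γ m}, q ∈ face u h c → form (κ • d - v) (normal u c) = 0 →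
      q + ε • (κ • d - v) ∈ face u h c := fun hqc hw =>
    ⟨hmem, by rw [form_add_left, form_smul_left, hw, mul_zero, add_zero, hqc.2]⟩
  have hw₀a : form (κ • d - v) (normal u a) = 0 := by rw [hw₀, hd.left, hva]; simp
  have hne : q ≠ q + ε • (κ • d - v) := by
    intro heq
    have h1 : ε • (κ • d - v) = 0 := by simpa using heq
    have h2 := (smul_eq_zero.1 h1).resolve_left hε.ne'
    have h3 := hw₀ (normal u b)
    rw [h2, hd.right, hvb, show form 0 (normal u b) = 0 by simp [form]] at h3
    linarith
  refine ⟨c₀, ⟨hc₀.2.1, q, ⟨hqa, hc₀.1⟩, _, ⟨hface hqa hw₀a, hface hc₀.1 hw₀c⟩, hne⟩, hc₀.2.2,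
    hc₀.1, hα₀, ?_⟩
  intro c hc hcb hqc
  by_contra hcc
  have hcA : c ∈ A := ⟨hqc, hc.1, hcb⟩
  have hα := hApos c hcA
  -- In the coordinates `(τ, s)` of a second point of a competing edge, the constraints of `b` and
  -- `c₀` force the slope of `c` to equal `κ`. Then `a`, `c`, `c₀` share a segment.
  obtain ⟨y, ⟨hya, hyc⟩, hyq⟩ := hc.2.exists_ne q
  have hy0 : form (y - q) (normal u a) = 0 := by rw [form_sub_left, hya.2, hqa.2, sub_self]
  have hexp := hd.expansion hΓ hP (y - q)
  rw [hy0, neg_zero, zero_smul, zero_add] at hexp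
  change y - q = form (y - q) v • v + _ at hexp
  generalize form (y - q) v = τ at hexp
  generalize form (y - q) d = s at hexp
  have hform : ∀ e, form (y - q) e = τ * form v e + s * form d e := fun e => by
    rw [hexp, form_add_left, form_smul_left, form_smul_left]
  have h1 : form (y - q) (normal u b) ≤ 0 := by
    have := hya.1 b
    rw [form_sub_left, hqb.2]; linarith
  have h2 : form (y - q) (normal u c₀) ≤ 0 := by
    have := hya.1 c₀
    rw [form_sub_left, hc₀.1.2]; linarith
  have h3 : form (y - q) (normal u c) = 0 := by rw [form_sub_left, hyc.2, hqc.2, sub_self]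
  rw [hform] at h1 h2 h3
  rw [hd.right, hvb, mul_zero, add_zero] at h1
  have hτ : τ ≤ 0 := by
    by_contra! hτ
    nlinarith
  have hτ0 : τ ≠ 0 := by
    rintro rfl
    have hs : s = 0 := by
      rw [zero_mul, zero_add] at h3
      exact (mul_eq_zero.1 h3).resolve_right hα.ne'
    rw [hs, zero_smul, zero_smul, zero_add] at hexp
    exact hyq (sub_eq_zero.1 hexp)
  have hτn : τ < 0 := hτ.lt_of_ne hτ0
  have hmin' : κ ≤ form v (normal u c) / form d (normal u c) := hmin c hcA
  have hv₀ : form v (normal u c₀) = κ * form d (normal u c₀) := by rw [hκ]; field_simp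
  have h4 : s = -τ * (form v (normal u c) / form d (normal u c)) := by
    field_simp; linarith
  have h5 : form v (normal u c) / form d (normal u c) = κ := by
    refine le_antisymm ?_ hmin'
    rw [hv₀, h4] at h2
    have h6 : -τ * (form v (normal u c) / form d (normal u c) - κ) * form d (normal u c₀) ≤ 0 := by
      linarith
    have h7 := nonpos_of_mul_nonpos_left h6 hα₀
    have h8 := nonpos_of_mul_nonpos_right h7 (neg_pos.2 hτn)
    linarith
  have hw₀c' : form (κ • d - v) (normal u c) = 0 := by
    rw [hw₀, ← h5]; field_simp; ring
  exact not_three_faces hΓ hP hc.1.symm hc₀.2.1.symm hcc hne hqa hqc hc₀.1 (hface hqa hw₀a)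
    (hface hqc hw₀c') (hface hc₀.1 hw₀c)

/-- The distances between the common points of two faces. -/
def edgeDistances (u : Fin m → Mink) (h : Fin m → ℝ) (a b : Label Γ m) : Set ℝ :=
  {s : ℝ | ∃ x ∈ face u h a ∩ face u h b, ∃ y ∈ face u h a ∩ face u h b,
    s = √(form (x - y) (x - y))}

/-- The length of an edge is the maximal distance of two of its points; the edge is not
degenerate. -/
theorem isGreatest_edgeLength (hΓ : IsFuchsianGroup Γ) (hP : IsConvexPolyhedron Γ u h)
    {a b : Label Γ m} (hb : b ∈ neighbors u h a) :
    0 < edgeLength u h h a b ∧ IsGreatest (edgeDistances u h a b) (edgeLength u h h a b) := by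
  obtain ⟨hba, x, ⟨hxa, hxb⟩, y, ⟨hya, hyb⟩, hxy⟩ := hb
  have hw : ∀ {e : Label Γ m} {x y}, x ∈ face u h e → y ∈ face u h e →
      form (y - x) (normal u e) = 0 := by
    intro e x y hx hy
    rw [form_sub_left, hx.2, hy.2, sub_self]
  obtain ⟨d, hd, τ, hτ, hyx⟩ := exists_isEdgeDir hΓ hP hba.symm (sub_ne_zero.2 hxy.symm)
    (hw hxa hya) (hw hxb hyb)
  have hd0 : d ≠ 0 := by
    rintro rfl
    simpa [form] using hd.unit
  have hstay : ∀ {z : Mink} {s : ℝ}, z ∈ face u h b → z + s • d ∈ face u h a →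
      z + s • d ∈ face u h b := fun hz hs =>
    ⟨hs.1, by rw [form_add_left, form_smul_left, hd.right, mul_zero, add_zero, hz.2]⟩
  -- The endpoints `q` and `p` of the edge are the exit points from the face in the directions `d`
  -- and `-d`.
  obtain ⟨t₁, ht₁, hqa, c₁, hqc, hdc₁⟩ := exists_exit hΓ hP hxa hd.left hd0
  obtain ⟨t₂, ht₂, hpa, c₂, hpc, hdc₂⟩ := exists_exit hΓ hP hxa hd.neg.left (neg_ne_zero.2 hd0)
  have hqb := hstay hxb hqa
  have hpb : x + t₂ • -d ∈ face u h b := by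
    rw [smul_neg, ← neg_smul] at hpa ⊢
    exact hstay hxb hpa
  have hτt : τ ≤ t₁ := by
    have h1 := hya.1 c₁
    rw [eq_add_of_sub_eq' hyx, form_add_left, ← hqc.2, form_add_left, form_smul_left,
      form_smul_left] at h1
    by_contra! hlt
    nlinarith
  set q := x + t₁ • d with hq
  set p := x + t₂ • -d with hp
  set ℓ := t₁ + t₂ with hℓ
  have hℓ0 : 0 < ℓ := by linarith
  have hpq : p = q - ℓ • d := by rw [hp, hq, hℓ]; module
  have hqp : q = p - ℓ • -d := by rw [hpq]; module
  obtain ⟨e₁, he₁, he₁b, hqe, hde₁, huniq₁⟩ := exists_unique_adjacent_edge hΓ hP hd hqa hqb hℓ0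
    (hpq ▸ hpa) (hpq ▸ hpb) ⟨c₁, hqc, hdc₁⟩
  obtain ⟨e₂, he₂, he₂b, hpe, hde₂, huniq₂⟩ := exists_unique_adjacent_edge hΓ hP hd.neg hpa hpb hℓ0
    (hqp ▸ hqa) (hqp ▸ hqb) ⟨c₂, hpc, hdc₂⟩
  have hpne : p ≠ q := by
    intro heq
    rw [hpq] at heq
    exact smul_ne_zero hℓ0.ne' hd0 (sub_eq_self.1 heq)
  have hpoint : ∀ z ∈ face u h a, z ∈ face u h b → ∃ s, 0 ≤ s ∧ s ≤ ℓ ∧ z = p + s • d := by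
    intro z hza hzb
    have h1 := hd.eq_smul hΓ hP (hw hpa hza) (hw hpb hzb)
    generalize form (z - p) d = s at h1
    have hz := eq_add_of_sub_eq' h1
    refine ⟨s, ?_, ?_, hz⟩
    · have h2 := hza.1 e₂
      rw [form_neg_left] at hde₂
      rw [hz, form_add_left, form_smul_left, hpe.2] at h2
      by_contra! hneg
      nlinarith
    · have h2 := hza.1 e₁
      have h3 := hqe.2
      rw [hqp, smul_neg, sub_neg_eq_add, form_add_left, form_smul_left] at h3
      rw [hz, form_add_left, form_smul_left] at h2
      by_contra! hneg
      nlinarith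
  have hadj : adjacentEdges u h a b = {e₁, e₂} := by
    ext c
    constructor
    · rintro ⟨hc, hcb, z, ⟨hza, hzb⟩, hzc⟩
      obtain ⟨s, hs0, hsℓ, hz⟩ := hpoint z hza hzb
      have hqc' := hqa.1 c
      have hpc' := hpa.1 c
      have hzc' := hzc.2
      rw [hqp, smul_neg, sub_neg_eq_add, form_add_left, form_smul_left] at hqc'
      rw [hz, form_add_left, form_smul_left] at hzc'
      -- A linear constraint valid on the whole edge and active at `z` forces `z` to be the endpoint
      -- given by this sign; sign zero would make the edge common to three faces.
      rcases lt_trichotomy (form d (normal u c)) 0 with hneg | h0 | hpos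
      · right
        have : s = 0 := by
          by_contra hne
          have := hs0.lt_of_ne' hne
          nlinarith
        rw [this, zero_smul, add_zero] at hz
        exact huniq₂ c hc hcb (hz ▸ hzc)
      · rw [h0, mul_zero, add_zero] at hzc' hqc'
        refine (not_three_faces hΓ hP hd.ne hc.1.symm hcb.symm hpne hpa hpb ⟨hpa.1, hzc'⟩ hqa hqb
          ⟨hqa.1, ?_⟩).elim
        rw [hqp, smul_neg, sub_neg_eq_add, form_add_left, form_smul_left, h0, mul_zero, add_zero,
          hzc']
      · left
        have : s = ℓ := by
          by_contra hne
          have := hsℓ.lt_of_ne hne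
          nlinarith
        rw [this] at hz
        have hzq : z = q := by rw [hz, hpq]; module
        exact huniq₁ c hc hcb (hzq ▸ hzc)
    · rintro (rfl | rfl)
      · exact ⟨he₁, he₁b, q, ⟨hqa, hqb⟩, hqe⟩
      · exact ⟨he₂, he₂b, p, ⟨hpa, hpb⟩, hpe⟩
  -- Without distinctness the sum over `{e₁, e₂}` would collapse to one partial length.
  have he : e₁ ≠ e₂ := by
    rintro rfl
    rw [form_neg_left] at hde₂
    linarith
  have hlen : edgeLength u h h a b = ℓ := by
    rw [edgeLength, hadj, finsum_mem_pair he, partialLength_eq hΓ hP hd hde₁ hqa.2 hqb.2 hqe.2,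
      partialLength_eq hΓ hP hd.neg hde₂ hpa.2 hpb.2 hpe.2, hqp]
    simp only [form_sub_left, form_neg_right, form_smul_left, form_neg_left, hd.unit]
    ring
  have hdist : ∀ s : ℝ, √(form (s • d) (s • d)) = |s| := fun s => by
    rw [form_smul_left, form_smul_right, hd.unit, mul_one, Real.sqrt_mul_self_eq_abs]
  rw [hlen]
  refine ⟨hℓ0, ⟨q, ⟨hqa, hqb⟩, p, ⟨hpa, hpb⟩, ?_⟩, ?_⟩
  · rw [show q - p = ℓ • d by rw [hpq]; module, hdist, abs_of_pos hℓ0]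
  · rintro _ ⟨z, ⟨hza, hzb⟩, z', ⟨hza', hzb'⟩, rfl⟩
    obtain ⟨s, hs0, hsℓ, rfl⟩ := hpoint z hza hzb
    obtain ⟨s', hs0', hsℓ', rfl⟩ := hpoint z' hza' hzb'
    rw [show p + s • d - (p + s' • d) = (s - s') • d by module, hdist, abs_le]
    constructor <;> linarith

theorem finite_neighbors (hΓ : IsFuchsianGroup Γ) (hP : IsConvexPolyhedron Γ u h)
    (a : Label Γ m) : (neighbors u h a).Finite :=
  (finite_faces_meeting hΓ hP a).subset fun _ hb => hb.2.nonempty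

/-- Infinitely many rays from one point of the face leave it through only finitely many faces. Two
of them therefore leave through the same face, at distinct points, which span an edge. -/
theorem neighbors_nonempty (hΓ : IsFuchsianGroup Γ) (hP : IsConvexPolyhedron Γ u h)
    (a : Label Γ m) : (neighbors u h a).Nonempty := by
  obtain ⟨x, hx, -⟩ := exists_sub_ne_smul hP a 0 0
  obtain ⟨y, hy, hyx⟩ := exists_sub_ne_smul hP a x 0
  obtain ⟨z, hz, hzx⟩ := exists_sub_ne_smul hP a x (y - x)
  have hyx0 : y - x ≠ 0 := by simpa using hyx 0
  have hdir : ∀ s : ℝ, (z - x) + s • (y - x) ≠ 0 := fun s hs =>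
    hzx (-s) (by rw [neg_smul]; exact eq_neg_of_add_eq_zero_left hs)
  have hdira : ∀ s : ℝ, form ((z - x) + s • (y - x)) (normal u a) = 0 := fun s => by
    simp only [form_add_left, form_sub_left, form_smul_left, hx.2, hy.2, hz.2]
    ring
  choose t ht hta c htc hc using fun s : ℕ => exists_exit hΓ hP hx (hdira s) (hdir s)
  -- For `s ≥ 0` the direction does not increase any constraint active at `x`, since `y` and `z` lie
  -- in the polyhedron.
  have ht0 : ∀ s, t s ≠ 0 := by
    intro s h0
    have h1 := htc s
    have h2 := hc s
    rw [h0, zero_smul, add_zero] at h1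
    have h3 := hy.1 (c s)
    have h4 := hz.1 (c s)
    have hs : (0 : ℝ) ≤ s := s.cast_nonneg
    rw [form_add_left, form_smul_left, form_sub_left, form_sub_left, h1.2] at h2
    nlinarith
  obtain ⟨s, -, s', -, hss, hcc⟩ := Set.infinite_univ.exists_ne_map_eq_of_mapsTo
    (f := c) (t := {b : Label Γ m | (face u h a ∩ face u h b).Nonempty})
    (fun s _ => ⟨_, hta s, htc s⟩)
    (finite_faces_meeting hΓ hP a)
  refine ⟨c s, ?_, _, ⟨hta s, htc s⟩, _, ⟨hta s', hcc ▸ htc s'⟩, fun heq => ?_⟩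
  · intro h0
    exact (hc s).ne' (h0 ▸ hdira s)
  · have h1 := add_left_cancel heq
    have h2 : (t s - t s') • (z - x) = (t s' * s' - t s * s) • (y - x) := by
      rw [← sub_eq_zero] at h1 ⊢
      rw [← h1]
      module
    by_cases htt : t s = t s'
    · rw [htt, sub_self, zero_smul, ← mul_sub] at h2
      have h3 := (smul_eq_zero.1 h2.symm).resolve_right hyx0
      have h4 := (mul_eq_zero.1 h3).resolve_left (ht0 s')
      exact hss (by exact_mod_cast (sub_eq_zero.1 h4).symm)
    · refine hzx ((t s - t s')⁻¹ * (t s' * s' - t s * s)) ?_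
      rw [mul_smul, ← h2, inv_smul_smul₀ (sub_ne_zero.2 htt)]

end Edges

/-! ### Symmetric edge weights and the quadratic form -/

section MixedCovolume

variable {Γ : Subgroup (Mink ≃ₗ[ℝ] Mink)} {m : ℕ} {u : Fin m → Mink} {h : Fin m → ℝ}

theorem normal_mul (u : Fin m → Mink) (γ : Γ) (a : Label Γ m) :
    normal u ((γ * a.1, a.2) : Label Γ m) = (γ : Mink ≃ₗ[ℝ] Mink) (normal u a) := rfl

theorem map_mem_polyhedron (hΓ : IsFuchsianGroup Γ) (γ : Γ) {x : Mink}
    (hx : x ∈ polyhedron Γ u h) : (γ : Mink ≃ₗ[ℝ] Mink) x ∈ polyhedron Γ u h := by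
  intro b
  have h1 : normal u b = (γ : Mink ≃ₗ[ℝ] Mink) (normal u ((γ⁻¹ * b.1, b.2) : Label Γ m)) := by
    rw [← normal_mul, mul_inv_cancel_left]
  rw [h1, hΓ.isometry _ γ.2]
  exact hx (γ⁻¹ * b.1, b.2)

theorem map_mem_face (hΓ : IsFuchsianGroup Γ) (γ : Γ) {a : Label Γ m} {x : Mink}
    (hx : x ∈ face u h a) :
    (γ : Mink ≃ₗ[ℝ] Mink) x ∈ face u h ((γ * a.1, a.2) : Label Γ m) :=
  ⟨map_mem_polyhedron hΓ γ hx.1, by rw [normal_mul, hΓ.isometry _ γ.2]; exact hx.2⟩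

theorem mul_mem_neighbors (hΓ : IsFuchsianGroup Γ) (γ : Γ) {a b : Label Γ m}
    (hb : b ∈ neighbors u h a) :
    ((γ * b.1, b.2) : Label Γ m) ∈ neighbors u h ((γ * a.1, a.2) : Label Γ m) := by
  obtain ⟨hba, x, ⟨hxa, hxb⟩, y, ⟨hya, hyb⟩, hxy⟩ := hb
  refine ⟨fun heq => hba ?_, _, ⟨map_mem_face hΓ γ hxa, map_mem_face hΓ γ hxb⟩, _,
    ⟨map_mem_face hΓ γ hya, map_mem_face hΓ γ hyb⟩, (γ : Mink ≃ₗ[ℝ] Mink).injective.ne hxy⟩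
  rw [Prod.mk.injEq, mul_right_inj] at heq
  exact Prod.ext heq.1 heq.2

theorem neighbors_symm {a b : Label Γ m} (hb : b ∈ neighbors u h a) : a ∈ neighbors u h b :=
  ⟨hb.1.symm, Set.inter_comm (face u h a) _ ▸ hb.2⟩

theorem edgeDistances_mul_subset (hΓ : IsFuchsianGroup Γ) (γ : Γ) (a b : Label Γ m) :
    edgeDistances u h a b ⊆
      edgeDistances u h ((γ * a.1, a.2) : Label Γ m) ((γ * b.1, b.2) : Label Γ m) := by
  rintro _ ⟨x, ⟨hxa, hxb⟩, y, ⟨hya, hyb⟩, rfl⟩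
  refine ⟨_, ⟨map_mem_face hΓ γ hxa, map_mem_face hΓ γ hxb⟩, _,
    ⟨map_mem_face hΓ γ hya, map_mem_face hΓ γ hyb⟩, ?_⟩
  rw [← map_sub, hΓ.isometry _ γ.2]

theorem edgeDistances_mul (hΓ : IsFuchsianGroup Γ) (γ : Γ) (a b : Label Γ m) :
    edgeDistances u h ((γ * a.1, a.2) : Label Γ m) ((γ * b.1, b.2) : Label Γ m) =
      edgeDistances u h a b := by
  refine (edgeDistances_mul_subset hΓ γ a b).antisymm' ?_
  have := edgeDistances_mul_subset (u := u) (h := h) hΓ γ⁻¹ (γ * a.1, a.2) (γ * b.1, b.2)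
  simpa only [inv_mul_cancel_left] using this

/-- The set `edgeDistances` is invariant under isometries of `Γ`, so its greatest element is too.
The same device gives `edgeLength_comm`, although the defining formula singles out the face `a`. -/
theorem edgeLength_mul (hΓ : IsFuchsianGroup Γ) (hP : IsConvexPolyhedron Γ u h) (γ : Γ)
    {a b : Label Γ m} (hb : b ∈ neighbors u h a) :
    edgeLength u h h ((γ * a.1, a.2) : Label Γ m) (γ * b.1, b.2) = edgeLength u h h a b := by
  have h1 := (isGreatest_edgeLength hΓ hP (mul_mem_neighbors hΓ γ hb)).2
  rw [edgeDistances_mul hΓ] at h1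
  exact h1.unique (isGreatest_edgeLength hΓ hP hb).2

theorem edgeLength_comm (hΓ : IsFuchsianGroup Γ) (hP : IsConvexPolyhedron Γ u h)
    {a b : Label Γ m} (hb : b ∈ neighbors u h a) :
    edgeLength u h h a b = edgeLength u h h b a := by
  have h1 := (isGreatest_edgeLength hΓ hP (neighbors_symm hb)).2
  rw [edgeDistances, Set.inter_comm] at h1
  exact (isGreatest_edgeLength hΓ hP hb).2.unique h1

theorem phi_mul (hΓ : IsFuchsianGroup Γ) (u : Fin m → Mink) (γ : Γ) (a b : Label Γ m) :
    phi u ((γ * a.1, a.2) : Label Γ m) (γ * b.1, b.2) = phi u a b := by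
  rw [phi, normal_mul, normal_mul, hΓ.isometry _ γ.2, phi]

theorem phi_comm (u : Fin m → Mink) (a b : Label Γ m) : phi u a b = phi u b a := by
  rw [phi, form_comm, phi]

theorem neighbors_congr {r : Fin m → ℝ} (hc : SameCombinatorics Γ u r h) (a : Label Γ m) :
    neighbors u r a = neighbors u h a := by
  ext b
  have := (hc {a, b}).2
  rw [Set.biInter_pair, Set.biInter_pair] at this
  exact and_congr_right fun _ => this

theorem adjacentEdges_congr {r : Fin m → ℝ} (hc : SameCombinatorics Γ u r h) (a b : Label Γ m) :
    adjacentEdges u r a b = adjacentEdges u h a b := by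
  ext c
  have := (hc {a, b, c}).1
  rw [Set.biInter_insert, Set.biInter_pair, Set.biInter_insert, Set.biInter_pair,
    ← Set.inter_assoc, ← Set.inter_assoc] at this
  exact and_congr (by rw [neighbors_congr hc]) (and_congr_right fun _ => this)

theorem edgeLength_congr {r : Fin m → ℝ} (hc : SameCombinatorics Γ u r h) (k : Fin m → ℝ)
    (a b : Label Γ m) : edgeLength u r k a b = edgeLength u h k a b := by
  rw [edgeLength, adjacentEdges_congr hc, edgeLength]

/-- The polyhedron `P` enters only through its adjacencies, so they may be read off from `h` itself,
where the lengths `ℓ_{ab}(h)` are genuine. -/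
theorem mixedCovolume_congr {r : Fin m → ℝ} (hc : SameCombinatorics Γ u r h)
    (k p q : Fin m → ℝ) : mixedCovolume Γ u r k p q = mixedCovolume Γ u h k p q := by
  simp only [mixedCovolume, mixedArea, neighbors_congr hc, edgeLength_congr hc]

theorem adjacentEdges_symm {a b c : Label Γ m} (hb : b ∈ neighbors u h a)
    (hc : c ∈ adjacentEdges u h a b) : b ∈ adjacentEdges u h a c :=
  ⟨hb, hc.2.1.symm, by rw [Set.inter_right_comm]; exact hc.2.2⟩

theorem omega_comm (u : Fin m → Mink) (a b c : Label Γ m) : omega u a b c = omega u a c b := by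
  rw [omega, form_comm, omega]

-- Inserting the formula for the lengths gives a bilinear form in edge supports with coefficients `1
-- / sin ω` for adjacent edges and `-cot ω` terms on the diagonal. Adjacency and `ω` are symmetric.
open Classical in
theorem sum_edgeSupport_mul_edgeLength_comm {a : Label Γ m} (hfin : (neighbors u h a).Finite)
    (p q : Fin m → ℝ) :
    ∑ b ∈ hfin.toFinset, edgeSupport u p a b * edgeLength u h q a b =
      ∑ b ∈ hfin.toFinset, edgeSupport u q a b * edgeLength u h p a b := by
  have hlen : ∀ k b, edgeLength u h k a b = ∑ c ∈ hfin.toFinset,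
      if c ∈ adjacentEdges u h a b then partialLength u k a b c else 0 := by
    intro k b
    rw [edgeLength, ← Finset.sum_filter, ← finsum_mem_coe_finset]
    congr! 3 with c
    simp only [Finset.coe_filter, Set.Finite.mem_toFinset]
    exact ⟨fun hc => ⟨hc.1, hc⟩, fun hc => hc.2⟩
  have hsplit : ∀ k l : Fin m → ℝ,
      ∑ b ∈ hfin.toFinset, edgeSupport u k a b * edgeLength u h l a b =
      (∑ b ∈ hfin.toFinset, ∑ c ∈ hfin.toFinset, if c ∈ adjacentEdges u h a b then
        edgeSupport u k a b * edgeSupport u l a c / Real.sin (omega u a b c) else 0) -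
      ∑ b ∈ hfin.toFinset, ∑ c ∈ hfin.toFinset, if c ∈ adjacentEdges u h a b then
        edgeSupport u k a b * edgeSupport u l a b * Real.cos (omega u a b c) /
          Real.sin (omega u a b c) else 0 := by
    intro k l
    simp only [← Finset.sum_sub_distrib, hlen, Finset.mul_sum]
    refine Finset.sum_congr rfl fun b _ => Finset.sum_congr rfl fun c _ => ?_
    split_ifs
    · rw [partialLength]; ring
    · simp
  rw [hsplit, hsplit]
  congr 1
  · rw [Finset.sum_comm]
    refine Finset.sum_congr rfl fun c hc => Finset.sum_congr rfl fun b hb => ?_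
    rw [Set.Finite.mem_toFinset] at hb hc
    have : c ∈ adjacentEdges u h a b ↔ b ∈ adjacentEdges u h a c :=
      ⟨adjacentEdges_symm hb, adjacentEdges_symm hc⟩
    simp only [this, omega_comm u a b c]
    split_ifs <;> ring
  · refine Finset.sum_congr rfl fun b _ => Finset.sum_congr rfl fun c _ => ?_
    split_ifs <;> ring

theorem mixedArea_eq_sum {a : Label Γ m} (hfin : (neighbors u h a).Finite) (p : Fin m → ℝ) :
    mixedArea u h p h a = 1 / 2 * ∑ b ∈ hfin.toFinset,
      edgeSupport u p a b * edgeLength u h h a b := by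
  rw [mixedArea, finsum_mem_eq_finite_toFinset_sum _ hfin, Finset.sum_add_distrib,
    sum_edgeSupport_mul_edgeLength_comm hfin h p]
  ring

/-- The weight of the edge `ab` in the quadratic form of the mixed covolumes. -/
noncomputable def edgeWeight (u : Fin m → Mink) (h : Fin m → ℝ) (a b : Label Γ m) : ℝ :=
  edgeLength u h h a b / Real.sinh (phi u a b)

theorem edgeWeight_pos (hΓ : IsFuchsianGroup Γ) (hP : IsConvexPolyhedron Γ u h)
    {a b : Label Γ m} (hb : b ∈ neighbors u h a) : 0 < edgeWeight u h a b :=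
  div_pos (isGreatest_edgeLength hΓ hP hb).1 (sinh_phi_pos hΓ hP hb.1.symm)

theorem edgeWeight_comm (hΓ : IsFuchsianGroup Γ) (hP : IsConvexPolyhedron Γ u h)
    {a b : Label Γ m} (hb : b ∈ neighbors u h a) : edgeWeight u h a b = edgeWeight u h b a := by
  rw [edgeWeight, edgeLength_comm hΓ hP hb, phi_comm, edgeWeight]

theorem edgeWeight_mul (hΓ : IsFuchsianGroup Γ) (hP : IsConvexPolyhedron Γ u h) (γ : Γ)
    {a b : Label Γ m} (hb : b ∈ neighbors u h a) :
    edgeWeight u h ((γ * a.1, a.2) : Label Γ m) (γ * b.1, b.2) = edgeWeight u h a b := by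
  rw [edgeWeight, edgeLength_mul hΓ hP γ hb, phi_mul hΓ, edgeWeight]

theorem inv_mem_neighbors (hΓ : IsFuchsianGroup Γ) {i : Fin m} {b : Label Γ m}
    (hb : b ∈ neighbors u h ((1, i) : Label Γ m)) :
    ((b.1⁻¹, i) : Label Γ m) ∈ neighbors u h ((1, b.2) : Label Γ m) := by
  have := mul_mem_neighbors hΓ b.1⁻¹ (neighbors_symm hb)
  simpa using this

theorem edgeWeight_inv (hΓ : IsFuchsianGroup Γ) (hP : IsConvexPolyhedron Γ u h) {i : Fin m}
    {b : Label Γ m} (hb : b ∈ neighbors u h ((1, i) : Label Γ m)) :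
    edgeWeight u h ((1, b.2) : Label Γ m) (b.1⁻¹, i) = edgeWeight u h ((1, i) : Label Γ m) b := by
  have := edgeWeight_mul hΓ hP b.1⁻¹ (neighbors_symm hb)
  rw [edgeWeight_comm hΓ hP hb, ← this]
  simp

/-- The edges of the faces of a fundamental domain, counted from each of their two sides. -/
noncomputable def edgeFinset (hΓ : IsFuchsianGroup Γ) (hP : IsConvexPolyhedron Γ u h) :
    Finset (Σ _ : Fin m, Label Γ m) :=
  Finset.univ.sigma fun i => (finite_neighbors hΓ hP (1, i)).toFinset

theorem mem_edgeFinset (hΓ : IsFuchsianGroup Γ) (hP : IsConvexPolyhedron Γ u h)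
    {e : Σ _ : Fin m, Label Γ m} :
    e ∈ edgeFinset hΓ hP ↔ e.2 ∈ neighbors u h ((1, e.1) : Label Γ m) := by
  simp [edgeFinset]

/-- Every edge of the quotient has two sides. -/
theorem sum_edgeWeight_swap (hΓ : IsFuchsianGroup Γ) (hP : IsConvexPolyhedron Γ u h)
    (F : Fin m → Fin m → ℝ) :
    ∑ e ∈ edgeFinset hΓ hP, F e.1 e.2.2 * edgeWeight u h ((1, e.1) : Label Γ m) e.2 =
      ∑ e ∈ edgeFinset hΓ hP, F e.2.2 e.1 * edgeWeight u h ((1, e.1) : Label Γ m) e.2 := by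
  have hmem : ∀ e ∈ edgeFinset hΓ hP,
      (⟨e.2.2, (e.2.1⁻¹, e.1)⟩ : Σ _ : Fin m, Label Γ m) ∈ edgeFinset hΓ hP := fun e he =>
    (mem_edgeFinset hΓ hP).2 (inv_mem_neighbors hΓ ((mem_edgeFinset hΓ hP).1 he))
  -- The edge between `(1, i)` and `(γ, j)`, seen from its other side and moved by `γ⁻¹`, is the
  -- edge between `(1, j)` and `(γ⁻¹, i)`. This is an involution.
  refine Finset.sum_nbij' (fun e => ⟨e.2.2, (e.2.1⁻¹, e.1)⟩) (fun e => ⟨e.2.2, (e.2.1⁻¹, e.1)⟩)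
    hmem hmem ?_ ?_ ?_
  · rintro ⟨i, γ, j⟩ -
    simp
  · rintro ⟨i, γ, j⟩ -
    simp
  · intro e he
    rw [edgeWeight_inv hΓ hP ((mem_edgeFinset hΓ hP).1 he)]

/-- The mixed covolume as a sum over the edges. -/
theorem mixedCovolume_eq_sum (hΓ : IsFuchsianGroup Γ) (hP : IsConvexPolyhedron Γ u h)
    (k p : Fin m → ℝ) :
    mixedCovolume Γ u h k p h = 1 / 6 * ∑ e ∈ edgeFinset hΓ hP,
      k e.1 * (p e.1 * Real.cosh (phi u ((1, e.1) : Label Γ m) e.2) - p e.2.2) *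
        edgeWeight u h ((1, e.1) : Label Γ m) e.2 := by
  rw [mixedCovolume, edgeFinset, Finset.sum_sigma, Finset.mul_sum, Finset.mul_sum]
  refine Finset.sum_congr rfl fun i _ => ?_
  rw [mixedArea_eq_sum (finite_neighbors hΓ hP _), Finset.mul_sum, Finset.mul_sum,
    Finset.mul_sum, Finset.mul_sum]
  refine Finset.sum_congr rfl fun b _ => ?_
  rw [edgeSupport, edgeWeight]
  ring

theorem mixedCovolume_comm (hΓ : IsFuchsianGroup Γ) (hP : IsConvexPolyhedron Γ u h)
    (k p : Fin m → ℝ) : mixedCovolume Γ u h k p h = mixedCovolume Γ u h p k h := by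
  have hsplit : ∀ k p : Fin m → ℝ, mixedCovolume Γ u h k p h = 1 / 6 *
      (∑ e ∈ edgeFinset hΓ hP, k e.1 * p e.1 * Real.cosh (phi u ((1, e.1) : Label Γ m) e.2) *
        edgeWeight u h ((1, e.1) : Label Γ m) e.2 -
      ∑ e ∈ edgeFinset hΓ hP, k e.1 * p e.2.2 * edgeWeight u h ((1, e.1) : Label Γ m) e.2) := by
    intro k p
    rw [mixedCovolume_eq_sum hΓ hP, ← Finset.sum_sub_distrib]
    congr 1
    exact Finset.sum_congr rfl fun e _ => by ring
  rw [hsplit, hsplit, sum_edgeWeight_swap hΓ hP fun i j => k i * p j]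
  simp only [mul_comm (k _) (p _)]

theorem mixedCovolume_self_pos (hΓ : IsFuchsianGroup Γ) (hP : IsConvexPolyhedron Γ u h)
    {k : Fin m → ℝ} (hk : k ≠ 0) : 0 < mixedCovolume Γ u h k k h := by
  have key : mixedCovolume Γ u h k k h = 1 / 6 * ∑ e ∈ edgeFinset hΓ hP,
      (k e.1 ^ 2 * (Real.cosh (phi u ((1, e.1) : Label Γ m) e.2) - 1) +
        (k e.1 - k e.2.2) ^ 2 / 2) * edgeWeight u h ((1, e.1) : Label Γ m) e.2 := by
    have h1 := sum_edgeWeight_swap hΓ hP fun i _ => k i ^ 2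
    -- Adding this vanishing sum completes the square `(k e.1 - k e.2.2) ^ 2 / 2`.
    have h2 : ∑ e ∈ edgeFinset hΓ hP, (k e.2.2 ^ 2 / 2 - k e.1 ^ 2 / 2) *
        edgeWeight u h ((1, e.1) : Label Γ m) e.2 = 0 := by
      rw [← sub_eq_zero, ← Finset.sum_sub_distrib] at h1
      rw [← mul_zero (-(1 / 2) : ℝ), ← h1, Finset.mul_sum]
      exact Finset.sum_congr rfl fun e _ => by ring
    rw [mixedCovolume_eq_sum hΓ hP, ← add_zero (Finset.sum _ _), ← h2, ← Finset.sum_add_distrib]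
    congr 1
    exact Finset.sum_congr rfl fun e _ => by ring
  have hcosh : ∀ e ∈ edgeFinset hΓ hP, 1 < Real.cosh (phi u ((1, e.1) : Label Γ m) e.2) := by
    intro e he
    have hne := ((mem_edgeFinset hΓ hP).1 he).1.symm
    rw [cosh_phi hΓ hP hne]
    exact one_lt_neg_form_normal hΓ hP hne
  obtain ⟨i, hi⟩ := Function.ne_iff.1 hk
  have hi : k i ≠ 0 := hi
  obtain ⟨b, hb⟩ := neighbors_nonempty hΓ hP ((1, i) : Label Γ m)
  rw [key]
  refine mul_pos (by norm_num) (Finset.sum_pos' (fun e he => ?_)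
    ⟨⟨i, b⟩, (mem_edgeFinset hΓ hP).2 hb, ?_⟩)
  · have h1 := sub_pos.2 (hcosh e he)
    have h2 := edgeWeight_pos hΓ hP ((mem_edgeFinset hΓ hP).1 he)
    positivity
  · have h1 := sub_pos.2 (hcosh ⟨i, b⟩ ((mem_edgeFinset hΓ hP).2 hb))
    have h2 := edgeWeight_pos hΓ hP hb
    have h3 : 0 < k i ^ 2 := by positivity
    exact mul_pos (add_pos_of_pos_of_nonneg (mul_pos h3 h1) (by positivity)) h2

end MixedCovolume

end Fuchsian

theorem theorem6p1 (Γ : Subgroup (Fuchsian.Mink ≃ₗ[ℝ] Fuchsian.Mink))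
    (hΓ : Fuchsian.IsFuchsianGroup Γ) (m : ℕ) (u : Fin m → Fuchsian.Mink) (r : Fin m → ℝ)
    (hP : Fuchsian.IsConvexPolyhedron Γ u r)
    (h : Fin m → ℝ) (hh : h ∈ Fuchsian.parallelClass Γ u r) :
    ∃ B : LinearMap.BilinForm ℝ (Fin m → ℝ),
      (∀ k p : Fin m → ℝ, B k p = Fuchsian.mixedCovolume Γ u r k p h) ∧
      (∀ k p : Fin m → ℝ, B k p = B p k) ∧
      (∀ k : Fin m → ℝ, k ≠ 0 → 0 < B k k) := by
  obtain ⟨hPh, hc⟩ := hh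
  simp only [Fuchsian.mixedCovolume_congr hc]
  have hadd : ∀ k k' p : Fin m → ℝ, Fuchsian.mixedCovolume Γ u h (k + k') p h =
      Fuchsian.mixedCovolume Γ u h k p h + Fuchsian.mixedCovolume Γ u h k' p h := by
    intro k k' p
    simp only [Fuchsian.mixedCovolume, Pi.add_apply, add_mul, Finset.sum_add_distrib, mul_add]
  have hsmul : ∀ (t : ℝ) (k p : Fin m → ℝ), Fuchsian.mixedCovolume Γ u h (t • k) p h =
      t • Fuchsian.mixedCovolume Γ u h k p h := by
    intro t k p
    simp only [Fuchsian.mixedCovolume, Pi.smul_apply, smul_eq_mul, mul_assoc, ← Finset.mul_sum]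
    ring
  refine ⟨LinearMap.mk₂ ℝ (fun k p => Fuchsian.mixedCovolume Γ u h k p h) hadd hsmul ?_ ?_,
    fun _ _ => rfl, Fuchsian.mixedCovolume_comm hΓ hPh,
    fun _ hk => Fuchsian.mixedCovolume_self_pos hΓ hPh hk⟩
  -- Linearity in the second argument is inherited from the first by symmetry.
  · intro k p p'
    simp only [Fuchsian.mixedCovolume_comm hΓ hPh k, hadd]
  · intro t k p
    simp only [Fuchsian.mixedCovolume_comm hΓ hPh k, hsmul]
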